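/- \textbf{Theorem (Resulting hierarchy).} An alphabet is a non-empty finite set of symbols; $\lambda$ is the empty word. For an alphabet $V$ and a language $L\subseteq V^*$ we say that, with respect to $V$, $L$ belongs to \begin{itemize} \item $\mathit{REG}$ if $L$ is regular; $\mathit{FIN}$ if $L$ is finite; $\mathit{MON}$ if $L=V^*$; $\mathit{NIL}$ if $L$ or $V^*\setminus L$ is finite; \item $\mathit{COMB}$ if $L=V^*X$ for some $X\subseteq V$; $\mathit{DEF}$ if $L=A\cup V^*B$ for finite $A,B\subseteq V^*$; $\mathit{SYDEF}$ if $L=EV^*H$ for regular $E,H\subseteq V^*$; \item $\mathit{SUF}$ if $L$ is regular and $xy\in L$ implies $y\in L$ for all $x,y\in V^*$; \item $\mathit{ORD}$ if $L$ is accepted by a deterministic finite automaton with a totally ordered state set $(Z,\preceq)$ such that $z\preceq z'$ implies $\delta(z,a)\preceq\delta(z',a)$ for every letter $a\in V$; \item $\mathit{COMM}$ (resp. $\mathit{CIRC}$) if $L$ is regular and contains with each word all its permutations (resp. all its circular shifts); \item $\mathit{NC}$ if $L$ is regular and there is $k\ge 1$ such that $xy^kz\in L\iff xy^{k+1}z\in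 L$ for all $x,y,z\in V^*$; \item $\mathit{SF}$ if $L$ is described by an expression built from $\emptyset$ and letters of $V$ by concatenation, union and complementation (in $V^*$); \item $\mathit{PS}$ if $L$ is regular and there is $m\ge 1$ such that, for every $x\in V^*$, the set $\{x^n : n\ge m\}$ is either disjoint from $L$ or contained in $L$; \item $\mathit{UF}$ if $L$ is described by an expression built from $\emptyset$ and letters of $V$ by concatenation and Kleene closure only; \item $\mathit{STAR}$ if $L=H^*$ for a regular $H\subseteq V^*$; $\mathit{LCOM}$, $\mathit{RCOM}$, $\mathit{2COM}$ if, respectively, $L=EG^*$, $L=G^*H$, $L=EG^*H$ for regular languages $E,G,H\subseteq V^*$ with $G\notin\{\emptyset,\{\lambda\}\}$. \end{itemize} Each of these names denotes the family of all languages that have the property with respect to some alphabet. Then the following holds. \begin{enumerate} \item $\mathit{NC}=\mathit{SF}$, with respect to every alphabet. \item For each of the following arrows $X\to Y$ we have the proper inclusion $X\subset Y$, and the inclusion holds already with respect to every single alphabet: $\mathit{MON}\to\mathit{STAR}$, $\mathit{MON}\to\mathit{SYDEF}$, $\mathit{MON}\to\mathit{COMM}$, $\mathit{MON}\to\mathit{NIL}$,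 $\mathit{MON}\to\mathit{SUF}$, $\mathit{FIN}\to\mathit{NIL}$, $\mathit{NIL}\to\mathit{DEF}$, $\mathit{COMB}\to\mathit{DEF}$, $\mathit{COMB}\to\mathit{SYDEF}$, $\mathit{DEF}\to\mathit{ORD}$, $\mathit{ORD}\to\mathit{NC}$, $\mathit{NC}\to\mathit{PS}$, $\mathit{SUF}\to\mathit{PS}$, $\mathit{SYDEF}\to\mathit{PS}$, $\mathit{SYDEF}\to\mathit{LCOM}$, $\mathit{SYDEF}\to\mathit{RCOM}$, $\mathit{LCOM}\to\mathit{2COM}$, $\mathit{RCOM}\to\mathit{2COM}$, $\mathit{STAR}\to\mathit{UF}$, $\mathit{COMM}\to\mathit{CIRC}$, $\mathit{2COM}\to\mathit{REG}$, $\mathit{UF}\to\mathit{REG}$, $\mathit{CIRC}\to\mathit{REG}$, $\mathit{PS}\to\mathit{REG}$. \item Any two of the $18$ families $\mathit{FIN}$, $\mathit{MON}$, $\mathit{NIL}$, $\mathit{COMB}$, $\mathit{DEF}$, $\mathit{SYDEF}$, $\mathit{SUF}$, $\mathit{ORD}$, $\mathit{NC}=\mathit{SF}$, $\mathit{PS}$,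 $\mathit{COMM}$, $\mathit{CIRC}$, $\mathit{UF}$, $\mathit{STAR}$, $\mathit{LCOM}$, $\mathit{RCOM}$, $\mathit{2COM}$, $\mathit{REG}$ that are not connected by a directed path of these arrows (in either direction) are incomparable: neither is a subset of the other. \end{enumerate} -/

import Mathlib

open scoped Computability

namespace Subregular

/-- The `n`-th power `w ^ n` of a word `w` (`n`-fold concatenation). -/
def wordPow {V : Type} (w : List V) (n : ℕ) : List V :=
  (List.replicate n w).flatten

/-- A set of letters, regarded as a language of words of length one. -/
def letters {V : Type} (X : Set V) : Language V :=
  {w : List V | ∃ a ∈ X, w = [a]}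

/-- Languages described by an expression that is built from `∅` and single letters
by concatenation, union and complementation (with respect to all words over `V`). -/
inductive IsStarFree {V : Type} : Language V → Prop
  | empty : IsStarFree 0
  | letter (a : V) : IsStarFree {[a]}
  | concat {K L : Language V} : IsStarFree K → IsStarFree L → IsStarFree (K * L)
  | union {K L : Language V} : IsStarFree K → IsStarFree L → IsStarFree (K + L)
  | compl {K : Language V} : IsStarFree K → IsStarFree Kᶜ

/-- Languages described by an expression that is built from `∅` and single letters
by concatenation and Kleene closure only. -/
inductive IsUnionFree {V : Type} : Language V → Prop
  | empty : IsUnionFree 0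
  | letter (a : V) : IsUnionFree {[a]}
  | concat {K L : Language V} : IsUnionFree K → IsUnionFree L → IsUnionFree (K * L)
  | star {K : Language V} : IsUnionFree K → IsUnionFree K∗

/-- A language family, given by the languages over `V` that have the defining property
with respect to the alphabet `V`, for every alphabet `V`. The language of all words over `V`
is written `⊤`, the empty language `0`, and the language of the empty word alone `1`. -/
abbrev Family : Type 1 := ∀ V : Type, Set (Language V)

/-- Regular languages. -/
def REG : Family := fun _ => {L | L.IsRegular}

/-- Finite languages. -/
def FIN : Family := fun V => {L | Set.Finite (L : Set (List V))}

/-- Monoidal languages. -/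
def MON : Family := fun _ => {L | L = ⊤}

/-- Nilpotent languages. -/
def NIL : Family := fun V =>
  {L | Set.Finite (L : Set (List V)) ∨ Set.Finite (Lᶜ : Set (List V))}

/-- Combinational languages `V* X` with `X ⊆ V`. -/
def COMB : Family := fun V =>
  {L | ∃ X : Set V, L = ⊤ * letters X}

/-- Definite languages `A ∪ V* B` with finite `A` and `B`. -/
def DEF : Family := fun V =>
  {L | ∃ A B : Language V, Set.Finite (A : Set (List V)) ∧ Set.Finite (B : Set (List V)) ∧
    L = A + ⊤ * B}

/-- Symmetric definite languages `E V* H` with regular `E` and `H`. -/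
def SYDEF : Family := fun V =>
  {L | ∃ E H : Language V, E.IsRegular ∧ H.IsRegular ∧ L = E * ⊤ * H}

/-- Suffix-closed regular languages. -/
def SUF : Family := fun V =>
  {L | L.IsRegular ∧ ∀ x y : List V, x ++ y ∈ L → y ∈ L}

/-- Ordered languages: accepted by a deterministic finite automaton with totally ordered
state set all of whose letters act monotonically. -/
def ORD : Family := fun V =>
  {L | ∃ (Z : Type) (_ : Fintype Z) (_ : LinearOrder Z) (M : DFA V Z),
    (∀ (a : V) (z z' : Z), z ≤ z' → M.step z a ≤ M.step z' a) ∧ M.accepts = L}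

/-- Commutative regular languages. -/
def COMM : Family := fun V =>
  {L | L.IsRegular ∧ ∀ w w' : List V, w ∈ L → w.Perm w' → w' ∈ L}

/-- Circular regular languages. -/
def CIRC : Family := fun V =>
  {L | L.IsRegular ∧ ∀ u v : List V, u ++ v ∈ L → v ++ u ∈ L}

/-- Non-counting regular languages. -/
def NC : Family := fun V =>
  {L | L.IsRegular ∧ ∃ k : ℕ, 1 ≤ k ∧ ∀ x y z : List V,
    x ++ wordPow y k ++ z ∈ L ↔ x ++ wordPow y (k + 1) ++ z ∈ L}

/-- Star-free languages. -/
def SF : Family := fun _ => {L | IsStarFree L}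

/-- Power-separating regular languages. -/
def PS : Family := fun V =>
  {L | L.IsRegular ∧ ∃ m : ℕ, 1 ≤ m ∧ ∀ x : List V,
    (∀ n, m ≤ n → wordPow x n ∉ L) ∨ (∀ n, m ≤ n → wordPow x n ∈ L)}

/-- Union-free languages. -/
def UF : Family := fun _ => {L | IsUnionFree L}

/-- Star languages. -/
def STAR : Family := fun V => {L | ∃ H : Language V, H.IsRegular ∧ L = H∗}

/-- Left-sided comet languages. -/
def LCOM : Family := fun V =>
  {L | ∃ E G : Language V, E.IsRegular ∧ G.IsRegular ∧ G ≠ 0 ∧ G ≠ 1 ∧ L = E * G∗}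

/-- Right-sided comet languages. -/
def RCOM : Family := fun V =>
  {L | ∃ G H : Language V, G.IsRegular ∧ H.IsRegular ∧ G ≠ 0 ∧ G ≠ 1 ∧ L = G∗ * H}

/-- Two-sided comet languages. -/
def TCOM : Family := fun V =>
  {L | ∃ E G H : Language V, E.IsRegular ∧ G.IsRegular ∧ H.IsRegular ∧ G ≠ 0 ∧ G ≠ 1 ∧
    L = E * G∗ * H}

/-- The family as a plain set of languages: symbols are taken from a countably infinite
supply, and a language belongs to the family if it has the defining property with respect to
some alphabet (a non-empty finite set of symbols) over which it is a language. -/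
def Family.languages (X : Family) : Set (Language ℕ) :=
  {L | ∃ V : Finset ℕ, V.Nonempty ∧ ∃ K ∈ X {a : ℕ // a ∈ V}, L = Language.map Subtype.val K}

/-- Proper inclusion `X ⊂ Y`: it holds between the sets of languages, and the inclusion holds
already with respect to every single alphabet. -/
def ProperlyIncluded (X Y : Family) : Prop :=
  (∀ (V : Type) [Finite V] [Nonempty V], X V ⊆ Y V) ∧ X.languages ⊂ Y.languages

/-- Neither family is included in the other one. -/
def Incomparable (X Y : Family) : Prop :=
  ¬ X.languages ⊆ Y.languages ∧ ¬ Y.languages ⊆ X.languages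

/-- The nodes of the diagram; the node `nc` stands for the two coinciding families
`NC` and `SF`. -/
inductive Node : Type
  | fin | mon | nil | comb | def_ | sydef | suf | ord | nc | ps | comm | circ | uf | star
  | lcom | rcom | tcom | reg

/-- The family at a node. -/
def Node.family : Node → Family
  | .fin => FIN
  | .mon => MON
  | .nil => NIL
  | .comb => COMB
  | .def_ => DEF
  | .sydef => SYDEF
  | .suf => SUF
  | .ord => ORD
  | .nc => NC
  | .ps => PS
  | .comm => COMM
  | .circ => CIRC
  | .uf => UF
  | .star => STAR
  | .lcom => LCOM
  | .rcom => RCOM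
  | .tcom => TCOM
  | .reg => REG

/-- The arrows of the diagram. -/
inductive Arrow : Node → Node → Prop
  | mon_star : Arrow .mon .star
  | mon_sydef : Arrow .mon .sydef
  | mon_comm : Arrow .mon .comm
  | mon_nil : Arrow .mon .nil
  | mon_suf : Arrow .mon .suf
  | fin_nil : Arrow .fin .nil
  | nil_def : Arrow .nil .def_
  | comb_def : Arrow .comb .def_
  | comb_sydef : Arrow .comb .sydef
  | def_ord : Arrow .def_ .ord
  | ord_nc : Arrow .ord .nc
  | nc_ps : Arrow .nc .ps
  | suf_ps : Arrow .suf .ps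
  | sydef_ps : Arrow .sydef .ps
  | sydef_lcom : Arrow .sydef .lcom
  | sydef_rcom : Arrow .sydef .rcom
  | lcom_tcom : Arrow .lcom .tcom
  | rcom_tcom : Arrow .rcom .tcom
  | star_uf : Arrow .star .uf
  | comm_circ : Arrow .comm .circ
  | tcom_reg : Arrow .tcom .reg
  | uf_reg : Arrow .uf .reg
  | circ_reg : Arrow .circ .reg
  | ps_reg : Arrow .ps .reg

/-- There is a directed path (possibly of length zero) in the diagram. -/
def DirectedPath : Node → Node → Prop := Relation.ReflTransGen Arrow

end Subregular

/-!
The inclusions along the arrows are direct, apart from two.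

* `NC = SF` is Schützenberger's theorem. A star-free language is non-counting by induction on the
  expression. Conversely, the syntactic monoid of a non-counting language is finite and aperiodic,
  and `isStarFree_valueLanguage` shows that every language recognized by a finite aperiodic
  monoid `M` is star-free. The proof is by induction on `|M|` and on the number of letters. If the
  letter `c` has value `m ≠ 1`, a word is cut at its occurrences of `c`. The part between the first
  and the last `c` is evaluated in the local divisor `m M ∩ M m`, which is again aperiodic and
  smaller than `M` because it does not contain `1`; the letters of that evaluation are the values
  in `M` of the blocks between consecutive `c`'s. Substituting blocks for letters preserves
  star-freeness (`IsStarFree.blocks`), since the separator `c` makes the factorization unique.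
* `STAR ⊆ UF`: every regular language is a finite union of union-free languages, by solving the
  equations of an automaton with Arden's lemma, and `(K ∪ L)* = (K* L*)*` removes the unions below
  a star.

Among the remaining inclusions, `DEF ⊆ ORD` uses the automaton that remembers the last letters read,
ordered lexicographically with the most recent letter first, and `SYDEF ⊆ LCOM` uses
`E V* H = (E V* H)(V* H)*`.

Since the family at the end of a directed path contains the one at its start, all
non-inclusions follow from the 29 pairs of `separations`, each of which has an explicit witness
language. For the second family of a pair, a consequence of membership is derived that does not
refer to the alphabet, so that the witness is excluded over every alphabet. The least obvious
witness separates `NC` from `ORD`: the automaton `swapDFA` is aperiodic, but two of its letters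
connect the same two pairs of states in the two different ways, which no order on the states of any
automaton for the language tolerates (`swapDFA_accepts_notMem_ORD`).
-/

namespace Subregular

/-! ### Closure properties of regular languages -/

section Regular

variable {V : Type}

theorem wordPow_zero (w : List V) : wordPow w 0 = [] := rfl

theorem wordPow_succ (w : List V) (n : ℕ) : wordPow w (n + 1) = w ++ wordPow w n := by
  simp [wordPow, List.replicate_succ]

theorem wordPow_one (w : List V) : wordPow w 1 = w := by simp [wordPow]

theorem wordPow_add (w : List V) (m n : ℕ) : wordPow w (m + n) = wordPow w m ++ wordPow w n := by
  rw [wordPow, List.replicate_add, List.flatten_append]; rfl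

theorem wordPow_nil (n : ℕ) : wordPow ([] : List V) n = [] := by
  simp [wordPow]

theorem length_wordPow (w : List V) (n : ℕ) : (wordPow w n).length = n * w.length := by
  simp [wordPow]

theorem map_wordPow {W : Type} (f : V → W) (w : List V) (n : ℕ) :
    (wordPow w n).map f = wordPow (w.map f) n := by
  induction n with
  | zero => rfl
  | succ n ih => simp [wordPow_succ, ih]

theorem wordPow_singleton (a : V) (n : ℕ) : wordPow [a] n = List.replicate n a := by
  induction n with
  | zero => rfl
  | succ n ih => simp [wordPow_succ, ih, List.replicate_succ]

theorem evalFrom_wordPow {σ : Type} (M : DFA V σ) (w : List V) (n : ℕ) (s : σ) :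
    M.evalFrom s (wordPow w n) = (fun t => M.evalFrom t w)^[n] s := by
  induction n generalizing s with
  | zero => rfl
  | succ n ih => rw [wordPow_succ, DFA.evalFrom_of_append, ih, Function.iterate_succ_apply]

theorem isRegular_of_finite {L : Language V} (h : Set.Finite (L : Set (List V))) :
    L.IsRegular := by
  apply Language.IsRegular.of_finite_range_leftQuotient
  have hS : (⋃ w ∈ (L : Set (List V)), {v | v ∈ w.tails}).Finite :=
    h.biUnion fun w _ => w.tails.finite_toSet
  refine hS.finite_subsets.subset ?_
  rintro _ ⟨x, rfl⟩ y hy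
  exact Set.mem_biUnion (x := x ++ y) hy (by simp)

theorem isRegular_zero : (0 : Language V).IsRegular :=
  isRegular_of_finite Set.finite_empty

theorem isRegular_singleton (w : List V) : ({w} : Language V).IsRegular :=
  isRegular_of_finite (Set.finite_singleton w)

theorem isRegular_one : (1 : Language V).IsRegular := isRegular_singleton []

theorem isRegular_top : (⊤ : Language V).IsRegular := by
  have h := (isRegular_zero (V := V)).compl
  rwa [show (0 : Language V)ᶜ = ⊤ from Set.compl_empty] at h

/-- A left quotient of `K * L` depends only on one left quotient of `K` and on a set of left
quotients of `L`. -/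
theorem isRegular_mul {K L : Language V} (hK : K.IsRegular) (hL : L.IsRegular) :
    (K * L).IsRegular := by
  apply Language.IsRegular.of_finite_range_leftQuotient
  refine ((hK.finite_range_leftQuotient.prod hL.finite_range_leftQuotient.finite_subsets).image
    fun p => p.1 * L + (sSup p.2 : Language V)).subset ?_
  rintro _ ⟨x, rfl⟩
  refine ⟨(K.leftQuotient x, {Q | ∃ u ∈ K, ∃ y, u ++ y = x ∧ L.leftQuotient y = Q}),
    ⟨⟨x, rfl⟩, ?_⟩, ?_⟩
  · rintro _ ⟨u, _, y, _, rfl⟩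
    exact ⟨y, rfl⟩
  · ext z
    constructor
    · rintro (h | h)
      · obtain ⟨k, hk, l, hl, rfl⟩ := h
        exact ⟨x ++ k, hk, l, hl, by simp⟩
      · obtain ⟨Q, ⟨u, hu, y, rfl, rfl⟩, hz⟩ := h
        exact ⟨u, hu, y ++ z, hz, by simp⟩
    · rintro ⟨k, hk, l, hl, h⟩
      rcases List.append_eq_append_iff.1 h with ⟨t, rfl, rfl⟩ | ⟨t, rfl, rfl⟩
      · exact Or.inr ⟨L.leftQuotient t, ⟨k, hk, t, rfl, rfl⟩, hl⟩
      · exact Or.inl ⟨t, hk, l, hl, rfl⟩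

theorem append_mem_kstar_split {K : Language V} {x z : List V} (hx : x ≠ []) :
    x ++ z ∈ K∗ ↔ ∃ u ∈ K∗, ∃ y, u ++ y = x ∧ ∃ s, y ++ s ∈ K ∧ ∃ t ∈ K∗, s ++ t = z := by
  constructor
  · rintro ⟨l, h, hl⟩
    induction l generalizing x with
    | nil => simp_all
    | cons k l ih =>
      have hkl : ∀ y ∈ l, y ∈ K := fun y hy => hl y (List.mem_cons_of_mem _ hy)
      rw [List.flatten_cons] at h
      rcases List.append_eq_append_iff.1 h with ⟨t, rfl, rfl⟩ | ⟨t, rfl, h'⟩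
      · exact ⟨[], Language.nil_mem_kstar _, x, rfl, t, hl _ (by simp), _,
          Language.join_mem_kstar hkl, rfl⟩
      · by_cases ht : t = []
        · subst ht
          exact ⟨[], Language.nil_mem_kstar _, k, by simp, [], by simpa using hl k (by simp),
            l.flatten, Language.join_mem_kstar hkl, by simpa using h'⟩
        · obtain ⟨u, hu, y, rfl, r⟩ := ih ht h'.symm hkl
          obtain ⟨l', rfl, hl'⟩ := hu
          refine ⟨(k :: l').flatten, Language.join_mem_kstar ?_, y, by simp, r⟩
          intro w hw
          rcases List.mem_cons.1 hw with rfl | hw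
          · exact hl _ (by simp)
          · exact hl' w hw
  · rintro ⟨u, ⟨l, rfl, hl⟩, y, rfl, s, hys, t, ⟨m, rfl, hm⟩, rfl⟩
    refine ⟨l ++ (y ++ s) :: m, by simp, ?_⟩
    intro w hw
    rcases List.mem_append.1 hw with hw | hw
    · exact hl w hw
    · rcases List.mem_cons.1 hw with rfl | hw
      · exact hys
      · exact hm w hw

/-- A left quotient of `K∗` by a non-empty word depends only on a set of left quotients
of `K`. -/
theorem isRegular_kstar {K : Language V} (hK : K.IsRegular) : (K∗).IsRegular := by
  apply Language.IsRegular.of_finite_range_leftQuotient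
  refine (((hK.finite_range_leftQuotient.finite_subsets).image
    fun S => (sSup S : Language V) * K∗).union (Set.finite_singleton (K∗))).subset ?_
  rintro _ ⟨x, rfl⟩
  by_cases hx : x = []
  · subst hx
    exact Or.inr rfl
  left
  refine ⟨{Q | ∃ u ∈ K∗, ∃ y, u ++ y = x ∧ K.leftQuotient y = Q}, ?_, ?_⟩
  · rintro _ ⟨u, _, y, _, rfl⟩
    exact ⟨y, rfl⟩
  · ext z
    rw [Language.mem_leftQuotient, append_mem_kstar_split hx]
    constructor
    · rintro ⟨s, ⟨Q, ⟨u, hu, y, rfl, rfl⟩, hs⟩, t, ht, rfl⟩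
      exact ⟨u, hu, y, rfl, s, hs, t, ht, rfl⟩
    · rintro ⟨u, hu, y, rfl, s, hs, t, ht, rfl⟩
      exact ⟨s, ⟨_, ⟨u, hu, y, rfl, rfl⟩, hs⟩, t, ht, rfl⟩

theorem IsUnionFree.isRegular {L : Language V} (h : IsUnionFree L) : L.IsRegular := by
  induction h with
  | empty => exact isRegular_zero
  | letter a => exact isRegular_singleton _
  | concat _ _ hK hL => exact isRegular_mul hK hL
  | star _ hK => exact isRegular_kstar hK

theorem IsStarFree.isRegular {L : Language V} (h : IsStarFree L) : L.IsRegular := by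
  induction h with
  | empty => exact isRegular_zero
  | letter a => exact isRegular_singleton _
  | concat _ _ hK hL => exact isRegular_mul hK hL
  | union _ _ hK hL => exact hK.add hL
  | compl _ hK => exact hK.compl

end Regular

/-! ### Closure properties of star-free languages -/

section StarFreeClosure

variable {V : Type}

theorem IsStarFree.top : IsStarFree (⊤ : Language V) := by
  have h := (IsStarFree.empty (V := V)).compl
  rwa [show (0 : Language V)ᶜ = ⊤ from Set.compl_empty] at h

theorem IsStarFree.inter {K L : Language V} (hK : IsStarFree K) (hL : IsStarFree L) :
    IsStarFree (K ⊓ L) := by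
  have h := (hK.compl.union hL.compl).compl
  rwa [show (Kᶜ + Lᶜ)ᶜ = K ⊓ L from compl_sup.trans (by rw [compl_compl, compl_compl])] at h

theorem IsStarFree.iUnion {ι : Type} [Finite ι] (F : ι → Language V)
    (h : ∀ i, IsStarFree (F i)) : IsStarFree (⨆ i, F i) := by
  have key : ∀ s : Finset ι, IsStarFree (⨆ i ∈ s, F i) := by
    classical
    intro s
    induction s using Finset.induction_on with
    | empty =>
      convert IsStarFree.empty (V := V) using 1
      simp
      rfl
    | insert a s _ ih =>
      rw [Finset.iSup_insert]
      exact (h a).union ih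
  cases nonempty_fintype ι
  simpa using key Finset.univ

/-- The words all of whose letters belong to `B`. -/
def wordsOver (B : Set V) : Language V := {w : List V | ∀ a ∈ w, a ∈ B}

theorem mem_wordsOver {B : Set V} {w : List V} : w ∈ wordsOver B ↔ ∀ a ∈ w, a ∈ B := Iff.rfl

theorem mem_top_mul_letter_mul_top {a : V} {w : List V} :
    w ∈ (⊤ * {[a]} * ⊤ : Language V) ↔ a ∈ w := by
  constructor
  · rintro ⟨_, ⟨x, -, _, rfl, rfl⟩, y, -, rfl⟩
    simp
  · intro h
    obtain ⟨x, y, rfl⟩ := List.append_of_mem h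
    exact ⟨x ++ [a], ⟨x, trivial, [a], rfl, rfl⟩, y, trivial, by simp⟩

theorem IsStarFree.wordsOver [Finite V] (B : Set V) : IsStarFree (wordsOver B) := by
  have h := (IsStarFree.iUnion (fun a : {a : V // a ∉ B} => (⊤ * {[a.1]} * ⊤ : Language V))
    fun a => (IsStarFree.top.concat (.letter _)).concat .top).compl
  convert h using 1
  ext w
  change _ ↔ ¬ (w ∈ (⨆ a : {a : V // a ∉ B}, (⊤ * {[a.1]} * ⊤ : Language V)))
  rw [Language.mem_iSup]
  simp only [mem_top_mul_letter_mul_top, mem_wordsOver]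
  constructor
  · rintro h ⟨a, ha⟩
    exact a.2 (h _ ha)
  · intro h a ha
    by_contra hB
    exact h ⟨⟨a, hB⟩, ha⟩

theorem IsStarFree.one [Finite V] : IsStarFree (1 : Language V) := by
  convert IsStarFree.wordsOver (∅ : Set V) using 1
  ext w
  simp [mem_wordsOver, List.eq_nil_iff_forall_not_mem]

end StarFreeClosure

/-! ### Local divisors of aperiodic monoids -/

section LocalDivisor

variable {M : Type} [Monoid M] (c : M)

/-- The elements `x` for which `c * x` is also a left multiple of `c`. -/
def localSubmonoid : Submonoid M where
  carrier := {x | ∃ y, c * x = y * c}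
  one_mem' := ⟨1, by simp⟩
  mul_mem' := by
    rintro x x' ⟨y, hy⟩ ⟨y', hy'⟩
    exact ⟨y * y', by rw [← mul_assoc, hy, mul_assoc, hy', mul_assoc]⟩

/-- The congruence identifying `x` and `y` whenever `c * x = c * y`. -/
def localCon : Con (localSubmonoid c) where
  r x y := c * (x : M) = c * y
  iseqv := ⟨fun _ => rfl, Eq.symm, Eq.trans⟩
  mul' := by
    rintro w ⟨x, x', hx⟩ ⟨y, _⟩ ⟨z, _⟩ h₁ h₂
    change c * (w * y) = c * (x * z)
    change c * (w : M) = c * x at h₁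
    change c * y = c * z at h₂
    rw [← mul_assoc, h₁, hx, mul_assoc, h₂, ← mul_assoc, ← hx, mul_assoc]

/-- The local divisor of `M` at `c`. As a set it is `c M ∩ M c`, with the multiplication
`x c ∘ c y = x c y`; it is presented here as a quotient of a submonoid, through
`x ↦ c * x`. -/
abbrev LocalDivisor : Type := (localCon c).Quotient

/-- The embedding of the local divisor into the monoid as a set. -/
def LocalDivisor.val : LocalDivisor c → M :=
  Quotient.lift (fun x : localSubmonoid c => c * (x : M)) fun _ _ h => h

theorem LocalDivisor.val_mk (x : localSubmonoid c) :
    LocalDivisor.val c ((localCon c).mk' x) = c * x := rfl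

theorem LocalDivisor.val_injective : Function.Injective (LocalDivisor.val c) := by
  rintro ⟨x⟩ ⟨y⟩ h
  exact Quotient.sound h

instance [Finite M] : Finite (LocalDivisor c) :=
  Finite.of_injective _ (LocalDivisor.val_injective c)

/-- A monoid is aperiodic if all sequences of powers become constant. -/
def Aperiodic (M : Type) [Monoid M] : Prop := ∃ k : ℕ, ∀ x : M, x ^ k = x ^ (k + 1)

theorem Aperiodic.localDivisor (h : Aperiodic M) : Aperiodic (LocalDivisor c) := by
  obtain ⟨k, hk⟩ := h
  refine ⟨k, fun q => ?_⟩
  obtain ⟨x, rfl⟩ := (localCon c).mk'_surjective q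
  rw [← map_pow, ← map_pow, show x ^ k = x ^ (k + 1) from Subtype.ext (hk x)]

theorem Aperiodic.eq_one_of_mul_eq_one (h : Aperiodic M) {x : M} (hx : c * x = 1) : c = 1 := by
  obtain ⟨k, hk⟩ := h
  have hp : ∀ n : ℕ, c ^ n * x ^ n = 1 := by
    intro n
    induction n with
    | zero => simp
    | succ n ih => rw [pow_succ, pow_succ', mul_assoc, ← mul_assoc c, hx, one_mul, ih]
  have := congrArg (· * x ^ k) (hk c)
  simp only [pow_succ', mul_assoc, hp, mul_one] at this
  exact this.symm

theorem Aperiodic.card_localDivisor_lt [Finite M] (h : Aperiodic M) (hc : c ≠ 1) :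
    Nat.card (LocalDivisor c) < Nat.card M := by
  have := Fintype.ofFinite M
  have := Fintype.ofFinite (LocalDivisor c)
  rw [Nat.card_eq_fintype_card, Nat.card_eq_fintype_card]
  refine Fintype.card_lt_of_injective_of_notMem _ (LocalDivisor.val_injective c) (b := 1) ?_
  rintro ⟨⟨x⟩, hx⟩
  exact hc (h.eq_one_of_mul_eq_one c hx)

/-- The element `c * t * c` of the local divisor at `c`. -/
def LocalDivisor.sandwich (t : M) : LocalDivisor c :=
  (localCon c).mk' ⟨t * c, c * t, (mul_assoc _ _ _).symm⟩

theorem LocalDivisor.val_prod_sandwich (l : List M) :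
    LocalDivisor.val c (l.map (LocalDivisor.sandwich c)).prod = c * (l.map (· * c)).prod := by
  have : l.map (LocalDivisor.sandwich c) = (l.map fun t =>
      (⟨t * c, c * t, (mul_assoc _ _ _).symm⟩ : localSubmonoid c)).map (localCon c).mk' := by
    rw [List.map_map]; rfl
  rw [this, ← map_list_prod, val_mk, Submonoid.coe_list_prod, List.map_map]
  rfl

end LocalDivisor

/-! ### Substitution of blocks for letters -/

section Blocks

variable {A T : Type} (B : Set A) (c : A) (φ : List A → T)

/-- The concatenation of the given words, each followed by the letter `c`. -/
def encode (ws : List (List A)) : List A := (ws.map (· ++ [c])).flatten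

theorem encode_cons (w : List A) (ws : List (List A)) :
    encode c (w :: ws) = w ++ c :: encode c ws := by simp [encode]

theorem encode_append (ws ws' : List (List A)) :
    encode c (ws ++ ws') = encode c ws ++ encode c ws' := by simp [encode]

/-- The words `w₁ c w₂ c ⋯ wₙ c` with `wᵢ` over `B` for which the word of the values
`φ w₁, …, φ wₙ` belongs to `K`. -/
def blocks (K : Language T) : Language A :=
  {u : List A | ∃ ws : List (List A), (∀ w ∈ ws, w ∈ wordsOver B) ∧ encode c ws = u ∧
    ws.map φ ∈ K}

variable {B c}

theorem wordsOver_append_cons_inj (hc : c ∉ B) {w w' x x' : List A} (hw : w ∈ wordsOver B)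
    (hw' : w' ∈ wordsOver B) (h : w ++ c :: x = w' ++ c :: x') : w = w' ∧ x = x' := by
  induction w generalizing w' with
  | nil =>
    cases w' with
    | nil => simpa using h
    | cons a w' =>
      simp only [List.nil_append, List.cons_append, List.cons.injEq] at h
      exact absurd (hw' a (by simp)) (h.1 ▸ hc)
  | cons b w ih =>
    cases w' with
    | nil =>
      simp only [List.nil_append, List.cons_append, List.cons.injEq] at h
      exact absurd (hw b (by simp)) (h.1 ▸ hc)
    | cons a w' =>
      simp only [List.cons_append, List.cons.injEq] at h
      obtain ⟨rfl, h⟩ := h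
      obtain ⟨rfl, rfl⟩ := ih (fun y hy => hw y (by simp [hy])) (fun y hy => hw' y (by simp [hy])) h
      exact ⟨rfl, rfl⟩

theorem encode_inj (hc : c ∉ B) {ws ws' : List (List A)} (h : ∀ w ∈ ws, w ∈ wordsOver B)
    (h' : ∀ w ∈ ws', w ∈ wordsOver B) (e : encode c ws = encode c ws') : ws = ws' := by
  induction ws generalizing ws' with
  | nil =>
    cases ws' with
    | nil => rfl
    | cons w' ws' => simp [encode] at e
  | cons w ws ih =>
    cases ws' with
    | nil => simp [encode] at e
    | cons w' ws' =>
      rw [encode_cons, encode_cons] at e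
      obtain ⟨rfl, e'⟩ := wordsOver_append_cons_inj hc (h _ (by simp)) (h' _ (by simp)) e
      rw [ih (fun y hy => h y (by simp [hy])) (fun y hy => h' y (by simp [hy])) e']

theorem exists_encode_append {w : List A} (h : w ∈ wordsOver (insert c B)) :
    ∃ ws v, (∀ w ∈ ws, w ∈ wordsOver B) ∧ v ∈ wordsOver B ∧ encode c ws ++ v = w := by
  induction w using List.reverseRecOn with
  | nil => exact ⟨[], [], by simp, by simp [mem_wordsOver], rfl⟩
  | append_singleton w a ih =>
    obtain ⟨ws, v, hws, hv, rfl⟩ := ih fun y hy => h y (by simp [hy])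
    rcases h a (by simp) with rfl | ha
    · refine ⟨ws ++ [v], [], ?_, by simp [mem_wordsOver], by simp [encode]⟩
      intro y hy
      rcases List.mem_append.1 hy with hy | hy
      · exact hws y hy
      · rwa [List.mem_singleton.1 hy]
    · refine ⟨ws, v ++ [a], hws, ?_, by simp⟩
      intro y hy
      rcases List.mem_append.1 hy with hy | hy
      · exact hv y hy
      · rwa [List.mem_singleton.1 hy]

theorem encode_mem_wordsOver {ws : List (List A)} (h : ∀ w ∈ ws, w ∈ wordsOver B) :
    encode c ws ∈ wordsOver (insert c B) := by
  intro a ha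
  simp only [encode, List.mem_flatten, List.mem_map] at ha
  obtain ⟨_, ⟨w, hw, rfl⟩, ha⟩ := ha
  rcases List.mem_append.1 ha with ha | ha
  · exact Or.inr (h w hw a ha)
  · exact Or.inl (List.mem_singleton.1 ha)

theorem blocks_top_eq (hc : c ∉ B) :
    blocks B c φ ⊤ = wordsOver (insert c B) ⊓ (1 + ⊤ * {[c]}) := by
  ext u
  constructor
  · rintro ⟨ws, hws, rfl, -⟩
    refine ⟨encode_mem_wordsOver hws, ?_⟩
    rcases List.eq_nil_or_concat ws with rfl | ⟨ws, w, rfl⟩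
    · exact Or.inl rfl
    · exact Or.inr ⟨encode c ws ++ w, trivial, [c], rfl, by simp [encode]⟩
  · rintro ⟨h, h'⟩
    obtain ⟨ws, v, hws, hv, rfl⟩ := exists_encode_append h
    rcases List.eq_nil_or_concat v with rfl | ⟨v, a, rfl⟩
    · exact ⟨ws, hws, by simp, trivial⟩
    · exfalso
      rcases h' with h' | ⟨x, -, _, rfl, h'⟩
      · have h'' : encode c ws ++ v.concat a = [] := h'
        simp at h''
      · have h'' : (x ++ [c] : List A) = (encode c ws ++ v) ++ [a] := by simpa using h'
        have := (List.append_inj' h'' rfl).2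
        simp only [List.cons.injEq, and_true] at this
        exact hc (this ▸ hv a (by simp))

/-- Substituting the block language over a letter `t`, namely `(φ⁻¹ t ∩ B*) c`, for each letter
`t` preserves star-freeness. The separator `c` makes the factorization into blocks unique, which
is what complements need. -/
theorem IsStarFree.blocks [Finite A] (hc : c ∉ B)
    (hB : ∀ t, IsStarFree {w : List A | w ∈ Subregular.wordsOver B ∧ φ w = t})
    {K : Language T} (hK : IsStarFree K) : IsStarFree (blocks B c φ K) := by
  induction hK with
  | empty =>
    convert IsStarFree.empty (V := A)
    ext u
    exact ⟨fun ⟨_, _, _, h⟩ => h, fun h => h.elim⟩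
  | letter t =>
    convert (hB t).concat (.letter c)
    ext u
    constructor
    · rintro ⟨ws, hws, rfl, h⟩
      have h' : ws.map φ = [t] := h
      obtain ⟨w, rfl, rfl⟩ := List.map_eq_singleton_iff.1 h'
      exact ⟨w, ⟨hws _ (by simp), rfl⟩, [c], rfl, by simp [encode]⟩
    · rintro ⟨w, ⟨hw, rfl⟩, _, rfl, rfl⟩
      exact ⟨[w], by simpa using hw, by simp [encode], rfl⟩
  | concat _ _ ihK ihL =>
    convert ihK.concat ihL
    ext u
    constructor
    · rintro ⟨ws, hws, rfl, k, hk, l, hl, h⟩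
      obtain ⟨ws, ws', rfl, rfl, rfl⟩ := List.append_eq_map_iff.1 h
      exact ⟨_, ⟨ws, fun y hy => hws y (by simp [hy]), rfl, hk⟩,
        _, ⟨ws', fun y hy => hws y (by simp [hy]), rfl, hl⟩, (encode_append _ _ _).symm⟩
    · rintro ⟨_, ⟨ws, h, rfl, hk⟩, _, ⟨ws', h', rfl, hl⟩, rfl⟩
      refine ⟨ws ++ ws', ?_, encode_append _ _ _, _, hk, _, hl, by simp⟩
      intro y hy
      rcases List.mem_append.1 hy with hy | hy
      exacts [h y hy, h' y hy]
  | union _ _ ihK ihL =>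
    convert ihK.union ihL
    ext u
    constructor
    · rintro ⟨ws, hws, rfl, h | h⟩
      exacts [Or.inl ⟨ws, hws, rfl, h⟩, Or.inr ⟨ws, hws, rfl, h⟩]
    · rintro (⟨ws, hws, rfl, h⟩ | ⟨ws, hws, rfl, h⟩)
      exacts [⟨ws, hws, rfl, Or.inl h⟩, ⟨ws, hws, rfl, Or.inr h⟩]
  | @compl K _ ih =>
    have htop : IsStarFree (Subregular.blocks B c φ ⊤) := by
      rw [blocks_top_eq φ hc]
      exact (IsStarFree.wordsOver _).inter (IsStarFree.one.union (.concat .top (.letter c)))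
    convert htop.inter ih.compl
    ext u
    constructor
    · rintro ⟨ws, hws, rfl, h⟩
      refine ⟨⟨ws, hws, rfl, trivial⟩, ?_⟩
      rintro ⟨ws', hws', e, h'⟩
      exact h (encode_inj hc hws' hws e ▸ h')
    · rintro ⟨⟨ws, hws, rfl, -⟩, h⟩
      exact ⟨ws, hws, rfl, fun h' => h ⟨ws, hws, rfl, h'⟩⟩

end Blocks

/-! ### Schützenberger's theorem -/

section Schutzenberger

/-- The words over `B` whose image under the morphism extending `f` is `p`. -/
def valueLanguage {M A : Type} [Monoid M] (f : A → M) (B : Set A) (p : M) : Language A :=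
  {w : List A | w ∈ wordsOver B ∧ (w.map f).prod = p}

theorem prod_map_encode {M A : Type} [Monoid M] (f : A → M) (c : A) (ws : List (List A)) :
    ((encode c ws).map f).prod = ((ws.map fun w => (w.map f).prod).map (· * f c)).prod := by
  induction ws with
  | nil => rfl
  | cons w ws ih => simp [encode_cons, ih, mul_assoc]

/-- The words over `insert c B` with value `p`, according to whether `c` does not occur or how
the part between the first and the last `c` evaluates in the local divisor at `f c`. -/
theorem valueLanguage_insert {M A : Type} [Monoid M] (f : A → M) (B : Set A) (c : A) (p : M) :
    valueLanguage f (insert c B) p = valueLanguage f B p +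
      ⨆ x : {x : M × LocalDivisor (f c) × M // x.1 * LocalDivisor.val (f c) x.2.1 * x.2.2 = p},
        valueLanguage f B x.1.1 * {[c]} * blocks B c (fun w => (w.map f).prod)
          (valueLanguage (LocalDivisor.sandwich (f c)) Set.univ x.1.2.1) *
        valueLanguage f B x.1.2.2 := by
  ext w
  constructor
  · rintro ⟨h, rfl⟩
    obtain ⟨ws, v, hws, hv, rfl⟩ := exists_encode_append h
    cases ws with
    | nil => exact Or.inl ⟨hv, rfl⟩
    | cons w ws =>
      refine Or.inr (Language.mem_iSup.2 ⟨⟨((w.map f).prod,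
        ((ws.map fun w => (w.map f).prod).map (LocalDivisor.sandwich (f c))).prod,
        (v.map f).prod), ?_⟩, _, ⟨_, ⟨w, ⟨hws w (by simp), rfl⟩, [c], rfl, rfl⟩, encode c ws,
          ⟨ws, fun y hy => hws y (by simp [hy]), rfl, fun _ _ => trivial, rfl⟩, rfl⟩, v,
          ⟨hv, rfl⟩, by simp [encode_cons]⟩)
      simp only [LocalDivisor.val_prod_sandwich, encode_cons, ← prod_map_encode]
      simp [mul_assoc]
  · rintro (⟨h, rfl⟩ | h)
    · exact ⟨fun a ha => Or.inr (h a ha), rfl⟩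
    · obtain ⟨⟨⟨p₀, q, p₁⟩, hp⟩, h⟩ := Language.mem_iSup.1 h
      obtain ⟨_, ⟨_, ⟨w, ⟨hw, h₀⟩, _, rfl, rfl⟩, _, ⟨ws, hws, rfl, -, hq⟩, rfl⟩, v, ⟨hv, h₁⟩,
        rfl⟩ := h
      dsimp only at h₀ h₁ hp hq
      subst h₀ h₁ hq hp
      constructor
      · intro a ha
        simp only [List.append_assoc, List.mem_append, List.mem_singleton] at ha
        rcases ha with ha | rfl | ha | ha
        · exact Or.inr (hw a ha)
        · exact Or.inl rfl
        · exact encode_mem_wordsOver hws a ha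
        · exact Or.inr (hv a ha)
      · simp only [LocalDivisor.val_prod_sandwich, ← prod_map_encode]
        simp [mul_assoc]

/-- The main induction for Schützenberger's theorem, on the size of the aperiodic monoid and then
on the number of letters. If some letter `c` is not mapped to `1`, the words are cut at the
occurrences of `c`, and the part between the first and the last occurrence is evaluated in the
smaller local divisor at the image of `c`, with the monoid itself as alphabet. -/
theorem isStarFree_valueLanguage {M : Type} [Monoid M] [Finite M] (hM : Aperiodic M)
    {A : Type} [Finite A] (f : A → M) (B : Set A) (p : M) :
    IsStarFree (valueLanguage f B p) := by
  induction hn : Nat.card M using Nat.strong_induction_on generalizing M A with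
  | _ n ihn =>
  induction hm : B.ncard using Nat.strong_induction_on generalizing B p with
  | _ m ihm =>
  by_cases h : ∃ c ∈ B, f c ≠ 1
  · obtain ⟨c, hcB, hc⟩ := h
    have ih : ∀ q, IsStarFree (valueLanguage f (B \ {c}) q) := fun q =>
      ihm _ (hm ▸ Set.ncard_sdiff_singleton_lt_of_mem hcB B.toFinite) _ q rfl
    rw [← Set.insert_sdiff_self_of_mem hcB, valueLanguage_insert]
    refine (ih p).union (.iUnion _ fun x => (((ih _).concat (.letter c)).concat ?_).concat (ih _))
    exact .blocks _ (by simp) ih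
      (ihn _ (hn ▸ hM.card_localDivisor_lt _ hc) (hM.localDivisor _) _ _ _ rfl)
  · push Not at h
    have h1 : ∀ w ∈ wordsOver B, (w.map f).prod = 1 := by
      intro w hw
      apply List.prod_eq_one
      intro x hx
      obtain ⟨a, ha, rfl⟩ := List.mem_map.1 hx
      exact h a (hw a ha)
    by_cases hp : p = 1
    · convert IsStarFree.wordsOver B using 1
      ext w
      exact ⟨fun hw => hw.1, fun hw => ⟨hw, hp ▸ h1 w hw⟩⟩
    · convert IsStarFree.empty (V := A) using 1
      ext w
      exact ⟨fun hw => hp (hw.2 ▸ h1 w hw.1), fun hw => hw.elim⟩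

variable {V : Type}

/-- The syntactic congruence of a language. -/
def syntacticCon (L : Language V) : Con (FreeMonoid V) where
  r x y := ∀ u v : List V, u ++ x.toList ++ v ∈ L ↔ u ++ y.toList ++ v ∈ L
  iseqv := ⟨fun _ _ _ => Iff.rfl, fun h u v => (h u v).symm, fun h h' u v => (h u v).trans (h' u v)⟩
  mul' := by
    intro w x y z h h' u v
    have h₁ := h u (y.toList ++ v)
    have h₂ := h' (u ++ x.toList) v
    simp only [FreeMonoid.toList_mul, List.append_assoc] at h₁ h₂ ⊢
    exact h₁.trans h₂

/-- The transition monoid of an automaton for `L` maps onto the syntactic monoid. -/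
theorem finite_syntacticCon_quotient {L : Language V} (h : L.IsRegular) :
    Finite (syntacticCon L).Quotient := by
  obtain ⟨σ, _, M, rfl⟩ := h
  let e : FreeMonoid V → σ → σ := fun x s => M.evalFrom s x.toList
  have he : ∀ x y, e x = e y → syntacticCon M.accepts x y := by
    intro x y hxy u v
    have := congrFun hxy (M.eval u)
    simp only [e] at this
    rw [DFA.mem_accepts, DFA.mem_accepts, DFA.eval, DFA.evalFrom_of_append,
      DFA.evalFrom_of_append, DFA.evalFrom_of_append M _ (u ++ y.toList),
      DFA.evalFrom_of_append M _ u]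
    change M.evalFrom (M.evalFrom (M.eval u) _) v ∈ _ ↔ M.evalFrom (M.evalFrom (M.eval u) _) v ∈ _
    rw [this]
  refine Finite.of_injective (fun q : (syntacticCon M.accepts).Quotient => e (Quotient.out q)) ?_
  intro q q' h
  rw [← Quotient.out_eq q, ← Quotient.out_eq q']
  exact Quotient.sound (he _ _ h)

theorem toList_pow (x : FreeMonoid V) (n : ℕ) : (x ^ n).toList = wordPow x.toList n := by
  induction n with
  | zero => rfl
  | succ n ih => rw [pow_succ', FreeMonoid.toList_mul, ih, wordPow_succ]

theorem isStarFree_of_mem_NC [Finite V] {L : Language V} (h : L ∈ NC V) : IsStarFree L := by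
  obtain ⟨hreg, k, -, hk⟩ := h
  have := finite_syntacticCon_quotient hreg
  have hap : Aperiodic (syntacticCon L).Quotient := by
    refine ⟨k, fun q => ?_⟩
    obtain ⟨x, rfl⟩ := (syntacticCon L).mk'_surjective q
    rw [← map_pow, ← map_pow]
    refine Quotient.sound fun u v => ?_
    rw [toList_pow, toList_pow]
    exact hk u x.toList v
  let f : V → (syntacticCon L).Quotient := fun a => (syntacticCon L).mk' (FreeMonoid.of a)
  have hf : ∀ w : List V, (w.map f).prod = (syntacticCon L).mk' (FreeMonoid.ofList w) := by
    intro w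
    induction w with
    | nil => rfl
    | cons a w ih => rw [List.map_cons, List.prod_cons, ih, ← map_mul]; rfl
  have hL : L = ⨆ q : {q : (syntacticCon L).Quotient //
      ∃ w ∈ L, (syntacticCon L).mk' (FreeMonoid.ofList w) = q},
      valueLanguage f Set.univ q.1 := by
    ext w
    rw [Language.mem_iSup]
    constructor
    · intro hw
      exact ⟨⟨_, w, hw, rfl⟩, fun _ _ => trivial, hf w⟩
    · rintro ⟨⟨_, v, hv, rfl⟩, -, hw⟩
      rw [hf] at hw
      have h : syntacticCon L (FreeMonoid.ofList w) (FreeMonoid.ofList v) := Quotient.exact hw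
      simpa using (h [] []).2 (by simpa using hv)
  rw [hL]
  exact .iUnion _ fun q => isStarFree_valueLanguage hap f _ _

/-- A factorization of a power cuts one of the factors. -/
theorem wordPow_eq_append {y p q : List V} {n : ℕ} (hn : n ≠ 0) (h : wordPow y n = p ++ q) :
    ∃ i j y' y'', y' ++ y'' = y ∧ p = wordPow y i ++ y' ∧ q = y'' ++ wordPow y j ∧
      i + j + 1 = n := by
  induction n generalizing p with
  | zero => exact absurd rfl hn
  | succ n ih =>
    rw [wordPow_succ] at h
    rcases List.append_eq_append_iff.1 h with ⟨t, rfl, h'⟩ | ⟨t, rfl, rfl⟩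
    · by_cases hn' : n = 0
      · subst hn'
        obtain ⟨rfl, rfl⟩ := List.append_eq_nil_iff.1 h'.symm
        exact ⟨0, 0, y, [], by simp [wordPow_zero]⟩
      · obtain ⟨i, j, y', y'', rfl, rfl, rfl, e⟩ := ih hn' h'
        exact ⟨i + 1, j, y', y'', rfl, by simp [wordPow_succ], rfl, by omega⟩
    · exact ⟨0, n, p, t, rfl, by simp [wordPow_zero], rfl, by omega⟩

/-- A power of a word inside a product: the cut is in the word to the left, in the word to the
right, or inside one of the factors. -/
theorem append_wordPow_append_mem_mul {K L : Language V} {x y z : List V} {n : ℕ} (hn : n ≠ 0) :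
    x ++ wordPow y n ++ z ∈ K * L ↔
      (∃ u t, u ++ t = x ∧ u ∈ K ∧ t ++ wordPow y n ++ z ∈ L) ∨
      (∃ t v, t ++ v = z ∧ x ++ wordPow y n ++ t ∈ K ∧ v ∈ L) ∨
      (∃ i j y' y'', y' ++ y'' = y ∧ i + j + 1 = n ∧ x ++ wordPow y i ++ y' ∈ K ∧
        [] ++ wordPow y j ++ z ∈ (L.leftQuotient y'')) := by
  constructor
  · rintro ⟨u, hu, v, hv, h⟩
    dsimp only at h
    rcases List.append_eq_append_iff.1 h with ⟨t, h', rfl⟩ | ⟨t, rfl, rfl⟩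
    · rcases List.append_eq_append_iff.1 h' with ⟨s, rfl, hs⟩ | ⟨s, rfl, rfl⟩
      · obtain ⟨i, j, y', y'', rfl, rfl, rfl, e⟩ := wordPow_eq_append hn hs
        refine Or.inr (Or.inr ⟨i, j, y', y'', rfl, e, ?_, ?_⟩)
        · rw [List.append_assoc]
          exact hu
        · rw [List.append_assoc] at hv
          exact hv
      · exact Or.inl ⟨u, s, rfl, hu, hv⟩
    · exact Or.inr (Or.inl ⟨t, v, rfl, hu, hv⟩)
  · rintro (⟨u, t, rfl, hu, ht⟩ | ⟨t, v, rfl, ht, hv⟩ | ⟨i, j, y', y'', rfl, rfl, hu, hv⟩)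
    · exact ⟨u, hu, _, ht, by simp⟩
    · exact ⟨_, ht, v, hv, by simp⟩
    · refine ⟨_, hu, _, hv, ?_⟩
      simp [wordPow_add, wordPow_succ, wordPow_zero, add_assoc, add_comm j 1]

/-- The threshold of a product is `k + l + 1`: however a power of that length is cut, one of the
two parts still contains a power above its own threshold. -/
theorem IsStarFree.exists_noncounting {L : Language V} (h : IsStarFree L) :
    ∃ k, ∀ n, k ≤ n → ∀ x y z : List V,
      x ++ wordPow y n ++ z ∈ L ↔ x ++ wordPow y (n + 1) ++ z ∈ L := by
  induction h with
  | empty => exact ⟨0, fun _ _ _ _ _ => Iff.rfl⟩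
  | letter a =>
    refine ⟨2, fun n hn x y z => ?_⟩
    by_cases hy : y = []
    · subst hy
      rw [wordPow_nil, wordPow_nil]
    · have hl := List.length_pos_iff.2 hy
      have aux : ∀ m, 2 ≤ m → x ++ wordPow y m ++ z ∉ ({[a]} : Language V) := by
        intro m hm h
        have := congrArg List.length (show x ++ wordPow y m ++ z = [a] from h)
        simp only [List.length_append, length_wordPow, List.length_singleton] at this
        nlinarith
      exact iff_of_false (aux n hn) (aux _ (by omega))
  | @concat K L _ _ ihK ihL =>
    obtain ⟨k, hk⟩ := ihK
    obtain ⟨l, hl⟩ := ihL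
    refine ⟨k + l + 1, fun n hn x y z => ?_⟩
    rw [append_wordPow_append_mem_mul (by omega), append_wordPow_append_mem_mul (by omega)]
    refine or_congr ?_ (or_congr ?_ ⟨?_, ?_⟩)
    · exact exists₂_congr fun u t => and_congr_right fun _ => and_congr_right fun _ =>
        hl n (by omega) _ _ _
    · exact exists₂_congr fun u t => and_congr_right fun _ => and_congr_left fun _ =>
        hk n (by omega) _ _ _
    · rintro ⟨i, j, y', y'', e, hij, hu, hv⟩
      by_cases hi : k ≤ i
      · exact ⟨i + 1, j, y', y'', e, by omega, (hk i hi _ _ _).1 hu, hv⟩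
      · refine ⟨i, j + 1, y', y'', e, by omega, hu, ?_⟩
        have := (hl j (by omega) y'' y z).1 (by simpa using hv)
        simpa using this
    · rintro ⟨i, j, y', y'', e, hij, hu, hv⟩
      by_cases hi : k + 1 ≤ i
      · obtain ⟨i, rfl⟩ : ∃ i', i = i' + 1 := ⟨i - 1, by omega⟩
        exact ⟨i, j, y', y'', e, by omega, (hk i (by omega) _ _ _).2 hu, hv⟩
      · obtain ⟨j, rfl⟩ : ∃ j', j = j' + 1 := ⟨j - 1, by omega⟩
        refine ⟨i, j, y', y'', e, by omega, hu, ?_⟩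
        have := (hl j (by omega) y'' y z).2 (by simpa using hv)
        simpa using this
  | union _ _ ihK ihL =>
    obtain ⟨k, hk⟩ := ihK
    obtain ⟨l, hl⟩ := ihL
    exact ⟨max k l, fun n hn x y z =>
      or_congr (hk n (by omega) x y z) (hl n (by omega) x y z)⟩
  | compl _ ih =>
    obtain ⟨k, hk⟩ := ih
    exact ⟨k, fun n hn x y z => not_congr (hk n hn x y z)⟩

theorem NC_eq_SF [Finite V] : NC V = SF V := by
  refine Set.Subset.antisymm (fun L h => isStarFree_of_mem_NC h) fun L h => ?_
  obtain ⟨k, hk⟩ := IsStarFree.exists_noncounting h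
  exact ⟨IsStarFree.isRegular h, k + 1, by omega, fun x y z => hk (k + 1) (by omega) x y z⟩

end Schutzenberger

/-! ### Union-free languages -/

section UnionFree

variable {V : Type}

theorem IsUnionFree.one : IsUnionFree (1 : Language V) := by
  have h := (IsUnionFree.empty (V := V)).star
  rwa [kstar_zero] at h

variable (V) in
/-- The union-free languages as a submonoid of all languages under concatenation. -/
def unionFree : Submonoid (Language V) where
  carrier := {L | IsUnionFree L}
  one_mem' := .one
  mul_mem' := .concat

variable (V) in
/-- The finite unions of union-free languages. -/
def finiteUnionFree : Subsemiring (Language V) := (unionFree V).subsemiringClosure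

theorem IsUnionFree.mem_finiteUnionFree {L : Language V} (h : IsUnionFree L) :
    L ∈ finiteUnionFree V := by
  rw [← SetLike.mem_coe, finiteUnionFree, Submonoid.subsemiringClosure_coe]
  exact AddSubmonoid.subset_closure h

theorem mem_sum {ι : Type*} {s : Finset ι} {F : ι → Language V} {w : List V} :
    w ∈ ∑ i ∈ s, F i ↔ ∃ i ∈ s, w ∈ F i := by
  classical
  induction s using Finset.induction_on with
  | empty => simp
  | insert a s ha ih => rw [Finset.sum_insert ha, Language.mem_add, ih, Finset.exists_mem_insert]

theorem kstar_add_eq (K L : Language V) : (K + L)∗ = (K∗ * L∗)∗ := by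
  apply le_antisymm
  · apply kstar_mono
    rw [add_eq_sup]
    refine sup_le ?_ ?_
    · calc K ≤ K∗ := le_kstar
        _ = K∗ * 1 := (mul_one _).symm
        _ ≤ K∗ * L∗ := by gcongr; exact one_le_kstar
    · calc L ≤ L∗ := le_kstar
        _ = 1 * L∗ := (one_mul _).symm
        _ ≤ K∗ * L∗ := by gcongr; exact one_le_kstar
  · calc (K∗ * L∗)∗ ≤ ((K + L)∗ * (K + L)∗)∗ := by
          apply kstar_mono
          gcongr
          · rw [add_eq_sup]
            exact le_sup_left
          · rw [add_eq_sup]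
            exact le_sup_right
      _ = (K + L)∗ := by rw [kstar_mul_kstar, kstar_idem]

/-- The Kleene closure of a finite union is union-free, as `(K ∪ L)* = (K* L*)*`. -/
theorem isUnionFree_kstar_of_mem {L : Language V} (h : L ∈ finiteUnionFree V) :
    IsUnionFree (L∗) := by
  rw [← SetLike.mem_coe, finiteUnionFree, Submonoid.subsemiringClosure_coe] at h
  induction h using AddSubmonoid.closure_induction with
  | mem L h => exact .star h
  | zero => exact .star .empty
  | add K L _ _ hK hL =>
    rw [kstar_add_eq]
    exact .star (.concat hK hL)

/-- Gaussian elimination for systems of language equations whose coefficients do not contain the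
empty word: Arden's lemma solves one equation at a time. -/
theorem mem_finiteUnionFree_of_system (n : ℕ) (A : Fin n → Fin n → Language V)
    (B X : Fin n → Language V) (hA : ∀ i j, A i j ∈ finiteUnionFree V) (hA' : ∀ i j, [] ∉ A i j)
    (hB : ∀ i, B i ∈ finiteUnionFree V) (hX : ∀ i, X i = ∑ j, A i j * X j + B i) (i : Fin n) :
    X i ∈ finiteUnionFree V := by
  induction n with
  | zero => exact i.elim0
  | succ n ih =>
    have hstar : (A 0 0)∗ ∈ finiteUnionFree V :=
      (isUnionFree_kstar_of_mem (hA 0 0)).mem_finiteUnionFree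
    have h0 : X 0 = (A 0 0)∗ * (∑ j : Fin n, A 0 j.succ * X j.succ + B 0) := by
      rw [← Language.self_eq_mul_add_iff (hA' 0 0), ← add_assoc]
      rw [← Fin.sum_univ_succ fun j => A 0 j * X j]
      exact hX 0
    have hs : ∀ i : Fin n, X i.succ ∈ finiteUnionFree V := by
      refine ih (fun i j => A i.succ 0 * (A 0 0)∗ * A 0 j.succ + A i.succ j.succ)
        (fun i => A i.succ 0 * (A 0 0)∗ * B 0 + B i.succ) (fun i => X i.succ) ?_ ?_ ?_ ?_
      · exact fun i j => add_mem (mul_mem (mul_mem (hA _ _) hstar) (hA _ _)) (hA _ _)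
      · rintro i j (h | h)
        · obtain ⟨_, ⟨x, hx, y, -, rfl⟩, z, -, h⟩ := h
          simp only [List.append_eq_nil_iff] at h
          exact hA' _ _ (h.1.1 ▸ hx)
        · exact hA' _ _ h
      · exact fun i => add_mem (mul_mem (mul_mem (hA _ _) hstar) (hB _)) (hB _)
      · intro i
        conv_lhs => rw [hX, Fin.sum_univ_succ, h0]
        simp only [add_mul, mul_add, Finset.mul_sum, Finset.sum_add_distrib, mul_assoc]
        abel
    refine Fin.cases ?_ hs i
    rw [h0]
    exact mul_mem hstar (add_mem (sum_mem fun j _ => mul_mem (hA _ _) (hs j)) (hB 0))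

/-- Every regular language is a finite union of union-free languages: the languages accepted from
the states of an automaton solve a right-linear system of equations. -/
theorem mem_finiteUnionFree_of_isRegular [Finite V] {L : Language V} (h : L.IsRegular) :
    L ∈ finiteUnionFree V := by
  classical
  obtain ⟨σ, _, M, rfl⟩ := h
  cases nonempty_fintype V
  let e := Fintype.equivFin σ
  have key := mem_finiteUnionFree_of_system (Fintype.card σ)
    (fun i j => ∑ a : V, if M.step (e.symm i) a = e.symm j then ({[a]} : Language V) else 0)
    (fun i => if e.symm i ∈ M.accept then 1 else 0) (fun i => M.acceptsFrom (e.symm i))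
    ?_ ?_ ?_ ?_ (e M.start)
  · simpa [DFA.accepts] using key
  · intro i j
    refine sum_mem fun a _ => ?_
    split_ifs
    exacts [(IsUnionFree.letter a).mem_finiteUnionFree, zero_mem _]
  · intro i j h
    obtain ⟨a, -, h⟩ := mem_sum.1 h
    split_ifs at h
    · have h' : [] = [a] := h
      simp at h'
    · exact h
  · intro i
    split_ifs
    exacts [one_mem _, zero_mem _]
  · intro i
    have h1 : ∀ s : σ, M.acceptsFrom s = (∑ a : V, {[a]} * M.acceptsFrom (M.step s a)) +
        if s ∈ M.accept then 1 else 0 := by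
      intro s
      ext w
      rw [Language.mem_add, mem_sum]
      cases w with
      | nil =>
        constructor
        · intro h
          have h' : s ∈ M.accept := h
          rw [if_pos h']
          exact Or.inr rfl
        · rintro (⟨a, -, x, rfl, y, -, h⟩ | h)
          · simp at h
          · split_ifs at h with h'
            · exact h'
            · exact h.elim
      | cons a w =>
        constructor
        · intro h
          exact Or.inl ⟨a, Finset.mem_univ a, [a], rfl, w, h, rfl⟩
        · rintro (⟨b, -, x, rfl, y, hy, h⟩ | h)
          · simp only [List.singleton_append, List.cons.injEq] at h
            obtain ⟨rfl, rfl⟩ := h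
            exact hy
          · split_ifs at h
            · exact absurd (show a :: w = [] from h) (by simp)
            · exact h.elim
    simp only [Finset.sum_mul]
    rw [Finset.sum_comm, h1]
    congr 1
    refine Finset.sum_congr rfl fun a _ => ?_
    rw [Finset.sum_eq_single (e (M.step (e.symm i) a))]
    · simp
    · intro j _ hj
      rw [if_neg, zero_mul]
      intro h
      exact hj (by simp [h])
    · simp

end UnionFree

/-! ### Iterates of a map on a finite set -/

section Iterate

variable {σ : Type} [Fintype σ] (f : σ → σ) (s : σ)

theorem exists_iterate_eq : ∃ i j, i < j ∧ j ≤ Fintype.card σ ∧ f^[i] s = f^[j] s := by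
  obtain ⟨i, j, hij, h⟩ := Fintype.exists_ne_map_eq_of_card_lt
    (fun n : Fin (Fintype.card σ + 1) => f^[n] s) (by simp)
  rcases lt_or_gt_of_ne hij with hlt | hlt
  · exact ⟨i, j, hlt, by omega, h⟩
  · exact ⟨j, i, hlt, by omega, h.symm⟩

/-- Once two iterates agree, all later ones recur. -/
theorem exists_iterate_recur : ∃ d, 0 < d ∧ ∀ n, Fintype.card σ ≤ n → ∀ t,
    f^[n + t * d] s = f^[n] s := by
  obtain ⟨i, j, hij, hj, h⟩ := exists_iterate_eq f s
  refine ⟨j - i, by omega, fun n hn t => ?_⟩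
  induction t with
  | zero => simp
  | succ t ih =>
    rw [← ih, show n + (t + 1) * (j - i) = (n - i + t * (j - i)) + j by rw [add_mul]; omega,
      show n + t * (j - i) = (n - i + t * (j - i)) + i by omega,
      Function.iterate_add_apply, ← h, ← Function.iterate_add_apply]

theorem exists_le_card_iterate_eq (n : ℕ) : ∃ m ≤ Fintype.card σ, f^[m] s = f^[n] s := by
  induction n using Nat.strong_induction_on with
  | _ n ih =>
  by_cases hn : n ≤ Fintype.card σ
  · exact ⟨n, hn, rfl⟩
  · obtain ⟨i, j, hij, hj, h⟩ := exists_iterate_eq f s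
    obtain ⟨m, hm, e⟩ := ih (n - j + i) (by omega)
    refine ⟨m, hm, e.trans ?_⟩
    rw [Function.iterate_add_apply, h, ← Function.iterate_add_apply, Nat.sub_add_cancel (by omega)]

theorem iterate_card_eq_of_monotone [LinearOrder σ] (hf : Monotone f) {n : ℕ}
    (hn : Fintype.card σ ≤ n) : f^[n] s = f^[n + 1] s := by
  obtain ⟨i, j, hij, hj, h⟩ := exists_iterate_eq f s
  have h1 : f^[i] s = f^[i + 1] s := by
    rcases le_total s (f s) with hs | hs
    · have hm := hf.monotone_iterate_of_le_map hs
      exact le_antisymm (hm (by omega)) ((hm (show i + 1 ≤ j by omega)).trans_eq h.symm)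
    · have hm := hf.antitone_iterate_of_map_le hs
      exact le_antisymm (h.le.trans (hm (show i + 1 ≤ j by omega))) (hm (by omega))
  rw [show n + 1 = n - i + (i + 1) by omega, Function.iterate_add_apply, ← h1,
    ← Function.iterate_add_apply, Nat.sub_add_cancel (by omega)]

end Iterate

/-! ### The inclusions -/

section Inclusions

variable {V : Type}

theorem MON_subset_STAR : MON V ⊆ STAR V := by
  rintro _ rfl
  exact ⟨⊤, isRegular_top, top_le_iff.1 le_kstar |>.symm⟩

theorem MON_subset_SYDEF : MON V ⊆ SYDEF V := by
  rintro _ rfl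
  exact ⟨1, 1, isRegular_one, isRegular_one, by simp⟩

theorem MON_subset_COMM : MON V ⊆ COMM V := by
  rintro _ rfl
  exact ⟨isRegular_top, fun _ _ _ _ => trivial⟩

theorem MON_subset_NIL : MON V ⊆ NIL V := by
  rintro _ rfl
  exact Or.inr (by convert Set.finite_empty; exact Set.compl_univ)

theorem MON_subset_SUF : MON V ⊆ SUF V := by
  rintro _ rfl
  exact ⟨isRegular_top, fun _ _ _ => trivial⟩

theorem FIN_subset_NIL : FIN V ⊆ NIL V := fun _ h => Or.inl h

theorem exists_length_lt_of_finite {L : Language V} (h : Set.Finite (L : Set (List V))) :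
    ∃ N, ∀ w ∈ L, w.length < N := by
  obtain ⟨N, hN⟩ := (h.image List.length).bddAbove
  exact ⟨N + 1, fun w hw => Nat.lt_succ_of_le (hN ⟨w, hw, rfl⟩)⟩

theorem NIL_subset_DEF [Finite V] : NIL V ⊆ DEF V := by
  rintro L (h | h)
  · exact ⟨L, 0, h, Set.finite_empty, by simp⟩
  · obtain ⟨N, hN⟩ := exists_length_lt_of_finite h
    refine ⟨{w : List V | w ∈ L ∧ w.length < N}, {w : List V | w.length = N},
      (List.finite_length_lt V N).subset fun w h => h.2, List.finite_length_eq V N, ?_⟩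
    ext w
    constructor
    · intro hw
      by_cases hl : w.length < N
      · exact Or.inl ⟨hw, hl⟩
      · refine Or.inr ⟨w.take (w.length - N), trivial, w.drop (w.length - N), ?_,
          List.take_append_drop _ _⟩
        change (w.drop (w.length - N)).length = N
        rw [List.length_drop]
        omega
    · rintro (hw | ⟨x, -, y, hy, rfl⟩)
      · exact hw.1
      · by_contra hxy
        have h1 := hN _ hxy
        have h2 : y.length = N := hy
        simp [h2] at h1

theorem finite_letters [Finite V] (X : Set V) : Set.Finite (letters X : Set (List V)) := by
  refine (X.toFinite.image fun a => [a]).subset ?_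
  rintro _ ⟨a, ha, rfl⟩
  exact ⟨a, ha, rfl⟩

theorem COMB_subset_DEF [Finite V] : COMB V ⊆ DEF V := by
  rintro _ ⟨X, rfl⟩
  exact ⟨0, letters X, Set.finite_empty, finite_letters X, by simp⟩

theorem COMB_subset_SYDEF [Finite V] : COMB V ⊆ SYDEF V := by
  rintro _ ⟨X, rfl⟩
  exact ⟨1, letters X, isRegular_one, isRegular_of_finite (finite_letters X), by simp⟩

theorem lt_of_take_lt_take [LinearOrder V] {r r' : List V} {k : ℕ}
    (h : List.Lex (· < ·) (r.take k) (r'.take k)) : List.Lex (· < ·) r r' := by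
  induction k generalizing r r' with
  | zero => simp at h
  | succ k ih =>
    cases r' with
    | nil => simp at h
    | cons b r' =>
      cases r with
      | nil => exact .nil
      | cons a r =>
        rw [List.take_succ_cons, List.take_succ_cons, List.cons_lex_cons_iff] at h
        exact List.cons_lex_cons_iff.2 (h.imp_right fun h => ⟨h.1, ih h.2⟩)

theorem take_le_take [LinearOrder V] {r r' : List V} (h : r ≤ r') (k : ℕ) :
    r.take k ≤ r'.take k :=
  not_lt.1 fun h' => not_lt.2 h (lt_of_take_lt_take h')

/-- An automaton that remembers the last `k` letters, most recent letter first, is ordered by the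
lexicographic order on its states. -/
theorem DEF_subset_ORD [Finite V] : DEF V ⊆ ORD V := by
  rintro _ ⟨A, B, hA, hB, rfl⟩
  obtain ⟨N, hN⟩ := exists_length_lt_of_finite hA
  obtain ⟨N', hN'⟩ := exists_length_lt_of_finite hB
  let k := max N N'
  cases nonempty_fintype V
  let e := Fintype.equivFin V
  let _ : LinearOrder V := LinearOrder.lift' e e.injective
  have hfin : Finite {r : List V // r.length ≤ k} := (List.finite_length_le V k).to_subtype
  let M : DFA V {r : List V // r.length ≤ k} :=
    ⟨fun z a => ⟨(a :: z.1).take k, by simp⟩, ⟨[], by simp⟩, {z | z.1.reverse ∈ A + ⊤ * B}⟩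
  refine ⟨{r : List V // r.length ≤ k}, Fintype.ofFinite _, inferInstance, M, ?_, ?_⟩
  · intro a z z' h
    exact take_le_take (List.cons_le_cons a h) k
  · have heval : ∀ w, (M.eval w).1 = w.reverse.take k := by
      intro w
      induction w using List.reverseRecOn with
      | nil => simp [M]
      | append_singleton w a ih =>
        rw [DFA.eval_append_singleton, List.reverse_append]
        change (a :: (M.eval w).1).take k = _
        rw [ih]
        cases hk : k with
        | zero => simp
        | succ j => simp [List.take_take]
    ext w
    change (M.eval w).1.reverse ∈ A + ⊤ * B ↔ _
    rw [heval]
    by_cases hl : w.length ≤ k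
    · rw [List.take_of_length_le (by simpa using hl), List.reverse_reverse]
    · have hA' : ∀ v : List V, k ≤ v.length → (v ∈ A + ⊤ * B ↔ v ∈ ⊤ * B) := by
        intro v hv
        refine ⟨fun h => h.resolve_left fun h => ?_, Or.inr⟩
        have := hN _ h
        omega
      rw [hA' w (by omega), hA' _ (by simp; omega)]
      rw [List.take_reverse, List.reverse_reverse]
      set u := w.take (w.length - k) with hu
      have hw : u ++ w.drop (w.length - k) = w := List.take_append_drop _ _
      set v := w.drop (w.length - k) with hv
      have hvl : v.length = k := by rw [hv, List.length_drop]; omega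
      constructor
      · rintro ⟨x, -, b, hb, h⟩
        exact ⟨u ++ x, trivial, b, hb, by rw [← hw, ← h]; simp⟩
      · rintro ⟨x, -, b, hb, h⟩
        have hbl := hN' _ hb
        rw [← hw] at h
        rcases List.append_eq_append_iff.1 h with ⟨t, -, hb'⟩ | ⟨t, -, ht⟩
        · have := congrArg List.length hb'
          rw [List.length_append] at this
          omega
        · exact ⟨t, trivial, b, hb, ht.symm⟩

theorem ORD_subset_NC : ORD V ⊆ NC V := by
  rintro L ⟨Z, _, _, M, hM, rfl⟩
  refine ⟨⟨Z, inferInstance, M, rfl⟩, Fintype.card Z + 1, by omega, fun x y z => ?_⟩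
  have hmono : ∀ w : List V, Monotone fun s => M.evalFrom s w := by
    intro w
    induction w with
    | nil => exact monotone_id
    | cons a w ih => exact fun s t h => ih (hM a s t h)
  simp only [DFA.mem_accepts, DFA.eval, DFA.evalFrom_of_append, evalFrom_wordPow]
  rw [iterate_card_eq_of_monotone _ _ (hmono y) (show Fintype.card Z ≤ Fintype.card Z + 1 by omega)]

theorem NC_subset_PS : NC V ⊆ PS V := by
  rintro L ⟨hreg, k, hk1, hk⟩
  refine ⟨hreg, k, hk1, fun x => ?_⟩
  have key : ∀ n, k ≤ n → (wordPow x n ∈ L ↔ wordPow x k ∈ L) := by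
    intro n hn
    induction n, hn using Nat.le_induction with
    | base => rfl
    | succ n hn ih =>
      rw [← ih]
      have := hk (wordPow x (n - k)) x []
      rw [List.append_nil, List.append_nil, ← wordPow_add, ← wordPow_add, ← add_assoc,
        Nat.sub_add_cancel hn] at this
      exact this.symm
  by_cases h : wordPow x k ∈ L
  · exact Or.inr fun n hn => (key n hn).2 h
  · exact Or.inl fun n hn h' => h ((key n hn).1 h')

/-- If a high power of `x` is in the language, then so are arbitrarily high powers, and their
suffixes are all the powers of `x`. -/
theorem SUF_subset_PS : SUF V ⊆ PS V := by
  rintro L ⟨hreg, hL⟩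
  obtain ⟨σ, _, M, rfl⟩ := hreg
  refine ⟨⟨σ, inferInstance, M, rfl⟩, Fintype.card σ + 1, by omega, fun x => ?_⟩
  obtain ⟨d, hd, h⟩ := exists_iterate_recur (fun s => M.evalFrom s x) M.start
  by_contra! hc
  obtain ⟨⟨n, hn, hnL⟩, n', -, hn'L⟩ := hc
  refine hn'L ?_
  have : wordPow x (n + n' * d) ∈ M.accepts := by
    rw [DFA.mem_accepts, DFA.eval, evalFrom_wordPow] at hnL ⊢
    rwa [h n (by omega)]
  refine hL (wordPow x (n + n' * d - n')) _ ?_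
  rw [← wordPow_add, Nat.sub_add_cancel]
  · exact this
  · nlinarith

/-- If a power of `x` has a prefix in a regular language, then some short power of `x` has one. -/
theorem exists_prefix_wordPow {σ : Type} [Fintype σ] (M : DFA V σ) {x e r : List V} {n : ℕ}
    (hn : n ≠ 0) (he : e ∈ M.accepts) (h : wordPow x n = e ++ r) :
    ∃ m ≤ Fintype.card σ + 1, ∃ e' ∈ M.accepts, ∃ r', wordPow x m = e' ++ r' := by
  obtain ⟨i, j, y', y'', rfl, rfl, rfl, -⟩ := wordPow_eq_append hn h
  obtain ⟨m, hm, hme⟩ := exists_le_card_iterate_eq (fun s => M.evalFrom s (y' ++ y'')) M.start i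
  refine ⟨m + 1, by omega, wordPow (y' ++ y'') m ++ y', ?_, y'', ?_⟩
  · rw [DFA.mem_accepts, DFA.eval, DFA.evalFrom_of_append, evalFrom_wordPow] at he ⊢
    rwa [hme]
  · rw [wordPow_add, wordPow_one, List.append_assoc]

/-- If a power of `x` has a suffix in a regular language, then some short power of `x` has one. -/
theorem exists_suffix_wordPow {σ : Type} [Fintype σ] (M : DFA V σ) {x e r : List V} {n : ℕ}
    (hn : n ≠ 0) (he : e ∈ M.accepts) (h : wordPow x n = r ++ e) :
    ∃ m ≤ Fintype.card σ + 1, ∃ e' ∈ M.accepts, ∃ r', wordPow x m = r' ++ e' := by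
  obtain ⟨i, j, y', y'', rfl, rfl, rfl, -⟩ := wordPow_eq_append hn h
  obtain ⟨m, hm, hme⟩ := exists_le_card_iterate_eq (fun s => M.evalFrom s (y' ++ y''))
    (M.eval y'') j
  refine ⟨m + 1, by omega, y'' ++ wordPow (y' ++ y'') m, ?_, y', ?_⟩
  · rw [DFA.mem_accepts, DFA.eval, DFA.evalFrom_of_append, evalFrom_wordPow] at he ⊢
    exact hme ▸ he
  · rw [wordPow_succ, List.append_assoc]

theorem SYDEF_subset_PS : SYDEF V ⊆ PS V := by
  rintro L ⟨E, H, hE, hH, rfl⟩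
  refine ⟨isRegular_mul (isRegular_mul hE isRegular_top) hH, ?_⟩
  obtain ⟨σ, _, M, rfl⟩ := hE
  obtain ⟨τ, _, N, rfl⟩ := hH
  refine ⟨(Fintype.card σ + 1) + (Fintype.card τ + 1), by omega, fun x => ?_⟩
  by_contra! hc
  obtain ⟨⟨n, hn, _, ⟨e, he, v, -, rfl⟩, h, hh, hx⟩, n', hn', hn'L⟩ := hc
  dsimp only at hx
  obtain ⟨i, hi, e', he', r', hr'⟩ := exists_prefix_wordPow M (by omega) he
    (hx.symm.trans (List.append_assoc _ _ _))
  obtain ⟨j, hj, h', hh', s', hs'⟩ := exists_suffix_wordPow N (by omega) hh hx.symm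
  refine hn'L ⟨_, ⟨e', he', r' ++ wordPow x (n' - i - j) ++ s', trivial, rfl⟩, h', hh', ?_⟩
  have hw : wordPow x n' = wordPow x i ++ wordPow x (n' - i - j) ++ wordPow x j := by
    rw [← wordPow_add, ← wordPow_add]
    congr 1
    omega
  rw [hw, hr', hs']
  simp

theorem exists_mem_of_ne_zero {L : Language V} (h : L ≠ 0) : ∃ w, w ∈ L :=
  Set.nonempty_iff_ne_empty.2 h

/-- Over a non-empty alphabet, `E V* H` is empty or contains a non-empty word. -/
theorem mul_top_mul_ne_one [Nonempty V] (E H : Language V) : E * ⊤ * H ≠ 1 := by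
  intro h1
  obtain ⟨a⟩ := ‹Nonempty V›
  obtain ⟨_, ⟨e, he, v, -, rfl⟩, h, hh, e1⟩ := h1.symm ▸ Language.nil_mem_one (α := V)
  have : e ++ [a] ++ h ∈ (1 : Language V) := h1 ▸ ⟨_, ⟨e, he, [a], trivial, rfl⟩, h, hh, rfl⟩
  have h' : e ++ [a] ++ h = [] := this
  simp at h'

/-- Since `V* H` absorbs `V* H` on its right, `E V* H = (E V* H)(V* H)*`. -/
theorem SYDEF_subset_LCOM [Nonempty V] : SYDEF V ⊆ LCOM V := by
  rintro _ ⟨E, H, hE, hH, rfl⟩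
  by_cases h0 : H = 0
  · subst h0
    exact ⟨0, ⊤, isRegular_zero, isRegular_top, fun h => (h ▸ trivial : [] ∈ (0 : Language V)),
      by simpa using mul_top_mul_ne_one (V := V) 1 1, by simp⟩
  · obtain ⟨h, hh⟩ := exists_mem_of_ne_zero h0
    refine ⟨E * ⊤ * H, ⊤ * H, isRegular_mul (isRegular_mul hE isRegular_top) hH,
      isRegular_mul isRegular_top hH, fun h' => ?_, by simpa using mul_top_mul_ne_one 1 H, ?_⟩
    · have : [] ++ h ∈ (⊤ * H) := ⟨[], trivial, h, hh, rfl⟩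
      rw [h'] at this
      exact this
    · refine le_antisymm ?_ (mul_kstar_le_self ?_)
      · calc _ = E * ⊤ * H * 1 := (mul_one _).symm
          _ ≤ _ := by gcongr; exact one_le_kstar
      · calc E * ⊤ * H * (⊤ * H) = E * (⊤ * H * ⊤) * H := by simp only [mul_assoc]
          _ ≤ E * ⊤ * H := by gcongr; exact fun _ _ => trivial

/-- Dually to `SYDEF_subset_LCOM`, `E V* H = (E V*)*(E V* H)`. -/
theorem SYDEF_subset_RCOM [Nonempty V] : SYDEF V ⊆ RCOM V := by
  rintro _ ⟨E, H, hE, hH, rfl⟩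
  by_cases h0 : E = 0
  · subst h0
    exact ⟨⊤, 0, isRegular_top, isRegular_zero, fun h => (h ▸ trivial : [] ∈ (0 : Language V)),
      by simpa using mul_top_mul_ne_one (V := V) 1 1, by simp⟩
  · obtain ⟨e, he⟩ := exists_mem_of_ne_zero h0
    refine ⟨E * ⊤, E * ⊤ * H, isRegular_mul hE isRegular_top,
      isRegular_mul (isRegular_mul hE isRegular_top) hH, fun h' => ?_,
      by simpa using mul_top_mul_ne_one E 1, ?_⟩
    · have : e ++ [] ∈ (E * ⊤) := ⟨e, he, [], trivial, rfl⟩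
      rw [h'] at this
      exact this
    · refine le_antisymm ?_ (kstar_mul_le_self ?_)
      · calc _ = 1 * (E * ⊤ * H) := (one_mul _).symm
          _ ≤ _ := by gcongr; exact one_le_kstar
      · calc E * ⊤ * (E * ⊤ * H) = E * (⊤ * E * ⊤) * H := by simp only [mul_assoc]
          _ ≤ E * ⊤ * H := by gcongr; exact fun _ _ => trivial

theorem LCOM_subset_TCOM : LCOM V ⊆ TCOM V := by
  rintro _ ⟨E, G, hE, hG, h0, h1, rfl⟩
  exact ⟨E, G, 1, hE, hG, isRegular_one, h0, h1, by simp⟩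

theorem RCOM_subset_TCOM : RCOM V ⊆ TCOM V := by
  rintro _ ⟨G, H, hG, hH, h0, h1, rfl⟩
  exact ⟨1, G, H, isRegular_one, hG, hH, h0, h1, by simp⟩

theorem STAR_subset_UF [Finite V] : STAR V ⊆ UF V := by
  rintro _ ⟨H, hH, rfl⟩
  exact isUnionFree_kstar_of_mem (mem_finiteUnionFree_of_isRegular hH)

theorem COMM_subset_CIRC : COMM V ⊆ CIRC V :=
  fun _ h => ⟨h.1, fun _ _ huv => h.2 _ _ huv List.perm_append_comm⟩

theorem TCOM_subset_REG : TCOM V ⊆ REG V := by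
  rintro _ ⟨E, G, H, hE, hG, hH, -, -, rfl⟩
  exact isRegular_mul (isRegular_mul hE (isRegular_kstar hG)) hH

theorem UF_subset_REG : UF V ⊆ REG V := fun _ h => IsUnionFree.isRegular h

theorem CIRC_subset_REG : CIRC V ⊆ REG V := fun _ h => h.1

theorem PS_subset_REG : PS V ⊆ REG V := fun _ h => h.1

theorem Arrow.subset {X Y : Node} (h : Arrow X Y) (V : Type) [Finite V] [Nonempty V] :
    X.family V ⊆ Y.family V := by
  cases h
  exacts [MON_subset_STAR, MON_subset_SYDEF, MON_subset_COMM, MON_subset_NIL, MON_subset_SUF,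
    FIN_subset_NIL, NIL_subset_DEF, COMB_subset_DEF, COMB_subset_SYDEF, DEF_subset_ORD,
    ORD_subset_NC, NC_subset_PS, SUF_subset_PS, SYDEF_subset_PS, SYDEF_subset_LCOM,
    SYDEF_subset_RCOM, LCOM_subset_TCOM, RCOM_subset_TCOM, STAR_subset_UF, COMM_subset_CIRC,
    TCOM_subset_REG, UF_subset_REG, CIRC_subset_REG, PS_subset_REG]

end Inclusions

/-! ### Consequences of membership over an arbitrary alphabet -/

section Languages

theorem mem_map {V W : Type} {f : V → W} {K : Language V} {w : List W} :
    w ∈ Language.map f K ↔ ∃ v ∈ K, v.map f = w := Iff.rfl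

theorem map_singleton {V W : Type} (f : V → W) (w : List V) :
    Language.map f {w} = ({w.map f} : Language W) := Set.image_singleton

variable {V : Finset ℕ} {K : Language {a : ℕ // a ∈ V}}

theorem map_mem_map_val {v : List {a : ℕ // a ∈ V}} :
    v.map Subtype.val ∈ Language.map Subtype.val K ↔ v ∈ K := by
  rw [mem_map]
  constructor
  · rintro ⟨u, hu, h⟩
    rwa [← List.map_injective_iff.2 Subtype.val_injective h]
  · exact fun h => ⟨v, h, rfl⟩

theorem mem_of_mem_map_val {w : List ℕ} (h : w ∈ Language.map Subtype.val K) :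
    ∀ a ∈ w, a ∈ V := by
  obtain ⟨v, -, rfl⟩ := h
  intro a ha
  obtain ⟨b, -, rfl⟩ := List.mem_map.1 ha
  exact b.2

theorem exists_map_val_eq {w : List ℕ} (h : ∀ a ∈ w, a ∈ V) :
    ∃ v : List {a : ℕ // a ∈ V}, v.map Subtype.val = w :=
  ⟨w.attachWith (· ∈ V) h, by simp⟩

theorem map_val_injective : Function.Injective
    (Language.map (Subtype.val : {a : ℕ // a ∈ V} → ℕ)) :=
  Set.image_injective.2 (List.map_injective_iff.2 Subtype.val_injective)

theorem mem_wordPow {W : Type} {w : List W} {n : ℕ} {a : W} (h : a ∈ wordPow w n) : a ∈ w := by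
  simp only [wordPow, List.mem_flatten, List.mem_replicate] at h
  obtain ⟨_, ⟨-, rfl⟩, h⟩ := h
  exact h

theorem subset_wordPow {W : Type} {w : List W} {n : ℕ} (hn : 1 ≤ n) {a : W} (h : a ∈ w) :
    a ∈ wordPow w n := by
  obtain ⟨n, rfl⟩ : ∃ m, n = m + 1 := ⟨n - 1, by omega⟩
  rw [wordPow_succ]
  exact List.mem_append_left _ h

variable {L : Language ℕ}

theorem finite_of_mem_FIN (h : L ∈ FIN.languages) : Set.Finite (L : Set (List ℕ)) := by
  obtain ⟨V, -, K, hK, rfl⟩ := h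
  exact Set.Finite.image _ hK

theorem nil_notMem_of_mem_COMB (h : L ∈ COMB.languages) : [] ∉ L := by
  obtain ⟨V, -, K, ⟨X, rfl⟩, rfl⟩ := h
  rintro ⟨_, ⟨x, -, _, ⟨a, -, rfl⟩, rfl⟩, h⟩
  simp at h

theorem nil_mem_of_mem_STAR (h : L ∈ STAR.languages) : [] ∈ L := by
  obtain ⟨V, -, K, ⟨H, -, rfl⟩, rfl⟩ := h
  exact ⟨[], Language.nil_mem_kstar _, rfl⟩

theorem mem_of_append_mem_of_mem_SUF (h : L ∈ SUF.languages) {x y : List ℕ} (hxy : x ++ y ∈ L) :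
    y ∈ L := by
  obtain ⟨V, -, K, ⟨-, hK⟩, rfl⟩ := h
  obtain ⟨v, hv, e⟩ := hxy
  obtain ⟨x, y, rfl, rfl, rfl⟩ := List.map_eq_append_iff.1 e
  exact ⟨y, hK _ _ hv, rfl⟩

theorem append_comm_mem_of_mem_CIRC (h : L ∈ CIRC.languages) {x y : List ℕ}
    (hxy : x ++ y ∈ L) : y ++ x ∈ L := by
  obtain ⟨V, -, K, ⟨-, hK⟩, rfl⟩ := h
  obtain ⟨v, hv, e⟩ := hxy
  obtain ⟨x, y, rfl, rfl, rfl⟩ := List.map_eq_append_iff.1 e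
  exact ⟨y ++ x, hK _ _ hv, by simp⟩

theorem perm_mem_of_mem_COMM (h : L ∈ COMM.languages) {w w' : List ℕ}
    (hw : w ∈ L) (hp : w.Perm w') : w' ∈ L := by
  obtain ⟨V, -, K, ⟨-, hK⟩, rfl⟩ := h
  obtain ⟨v', rfl⟩ := exists_map_val_eq fun a ha => mem_of_mem_map_val hw a (hp.symm.subset ha)
  obtain ⟨v, hv, rfl⟩ := hw
  exact ⟨v', hK _ _ hv ((List.map_perm_map_iff Subtype.val_injective).1 hp), rfl⟩

theorem isUnionFree_of_mem_UF (h : L ∈ UF.languages) : IsUnionFree L := by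
  obtain ⟨V, -, K, hK, rfl⟩ := h
  have hK' : IsUnionFree K := hK
  clear hK
  induction hK' with
  | empty => simpa using IsUnionFree.empty
  | letter a => rw [map_singleton]; exact .letter _
  | concat _ _ hK hL => rw [map_mul]; exact hK.concat hL
  | star _ hK => rw [Language.map_kstar]; exact hK.star

theorem map_val_ne {G K : Language {a : ℕ // a ∈ V}} (h : G ≠ K) :
    Language.map Subtype.val G ≠ Language.map Subtype.val K := map_val_injective.ne h

theorem eq_of_mem_TCOM (h : L ∈ TCOM.languages) :
    ∃ E G H : Language ℕ, G ≠ 0 ∧ G ≠ 1 ∧ L = E * G∗ * H := by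
  obtain ⟨V, -, K, ⟨E, G, H, -, -, -, h0, h1, rfl⟩, rfl⟩ := h
  refine ⟨Language.map Subtype.val E, Language.map Subtype.val G, Language.map Subtype.val H,
    ?_, ?_, ?_⟩
  · simpa using map_val_ne h0
  · simpa using map_val_ne h1
  · simp [Language.map_kstar]

theorem eq_of_mem_LCOM (h : L ∈ LCOM.languages) :
    ∃ E G : Language ℕ, G ≠ 0 ∧ G ≠ 1 ∧ L = E * G∗ := by
  obtain ⟨V, -, K, ⟨E, G, -, -, h0, h1, rfl⟩, rfl⟩ := h
  refine ⟨Language.map Subtype.val E, Language.map Subtype.val G, ?_, ?_, ?_⟩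
  · simpa using map_val_ne h0
  · simpa using map_val_ne h1
  · simp [Language.map_kstar]

theorem eq_of_mem_RCOM (h : L ∈ RCOM.languages) :
    ∃ G H : Language ℕ, G ≠ 0 ∧ G ≠ 1 ∧ L = G∗ * H := by
  obtain ⟨V, -, K, ⟨G, H, -, -, h0, h1, rfl⟩, rfl⟩ := h
  refine ⟨Language.map Subtype.val G, Language.map Subtype.val H, ?_, ?_, ?_⟩
  · simpa using map_val_ne h0
  · simpa using map_val_ne h1
  · simp [Language.map_kstar]

theorem powers_of_mem_PS (h : L ∈ PS.languages) :
    ∃ m, ∀ x, (∀ n, m ≤ n → wordPow x n ∉ L) ∨ (∀ n, m ≤ n → wordPow x n ∈ L) := by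
  obtain ⟨V, -, K, ⟨-, m, hm, hK⟩, rfl⟩ := h
  refine ⟨m, fun x => ?_⟩
  by_cases hx : ∀ a ∈ x, a ∈ V
  · obtain ⟨v, rfl⟩ := exists_map_val_eq hx
    simp only [← map_wordPow, map_mem_map_val]
    exact hK v
  · refine Or.inl fun n hn h => hx fun a ha => ?_
    exact mem_of_mem_map_val h a (subset_wordPow (by omega) ha)

theorem noncounting_of_mem_NC (h : L ∈ NC.languages) :
    ∃ k, ∀ x y z, x ++ wordPow y k ++ z ∈ L ↔ x ++ wordPow y (k + 1) ++ z ∈ L := by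
  obtain ⟨V, -, K, ⟨-, k, hk, hK⟩, rfl⟩ := h
  refine ⟨k, fun x y z => ?_⟩
  by_cases hx : (∀ a ∈ x, a ∈ V) ∧ (∀ a ∈ y, a ∈ V) ∧ (∀ a ∈ z, a ∈ V)
  · obtain ⟨hx, hy, hz⟩ := hx
    obtain ⟨x, rfl⟩ := exists_map_val_eq hx
    obtain ⟨y, rfl⟩ := exists_map_val_eq hy
    obtain ⟨z, rfl⟩ := exists_map_val_eq hz
    simp only [← map_wordPow, ← List.map_append, map_mem_map_val]
    exact hK x y z
  · have key : ∀ n, 1 ≤ n → x ++ wordPow y n ++ z ∉ Language.map Subtype.val K := by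
      intro n hn h
      have h' := mem_of_mem_map_val h
      refine hx ⟨fun a ha => h' a ?_, fun a ha => h' a ?_, fun a ha => h' a ?_⟩
      · simp [ha]
      · simp [subset_wordPow hn ha]
      · simp [ha]
    exact iff_of_false (key k hk) (key _ (by omega))

/-- Over any alphabet, a nilpotent language is finite or contains all long words over the letters
that occur in it. -/
theorem finite_or_of_mem_NIL (h : L ∈ NIL.languages) : Set.Finite (L : Set (List ℕ)) ∨
    ∃ N, ∀ w : List ℕ, (∀ a ∈ w, ∃ v ∈ L, a ∈ v) → N ≤ w.length → w ∈ L := by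
  obtain ⟨V, -, K, hK, rfl⟩ := h
  refine hK.imp (fun h => h.image _) fun h => ?_
  obtain ⟨N, hN⟩ := exists_length_lt_of_finite h
  refine ⟨N, fun w hw hl => ?_⟩
  obtain ⟨v, rfl⟩ := exists_map_val_eq (V := V) fun a ha => by
    obtain ⟨v, hv, ha⟩ := hw a ha
    exact mem_of_mem_map_val hv a ha
  rw [map_mem_map_val]
  by_contra hv
  have := hN v hv
  rw [List.length_map] at hl
  omega

/-- Over any alphabet, long words of a definite language may be extended to the left by all words
over the letters that occur in it. -/
theorem append_mem_of_mem_DEF (h : L ∈ DEF.languages) : ∃ N, ∀ x : List ℕ,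
    (∀ a ∈ x, ∃ v ∈ L, a ∈ v) → ∀ w ∈ L, N ≤ w.length → x ++ w ∈ L := by
  obtain ⟨V, -, K, ⟨A, B, hA, -, rfl⟩, rfl⟩ := h
  obtain ⟨N, hN⟩ := exists_length_lt_of_finite hA
  refine ⟨N, ?_⟩
  rintro x hx _ ⟨w, hw, rfl⟩ hl
  obtain ⟨x, rfl⟩ := exists_map_val_eq (V := V) fun a ha => by
    obtain ⟨v, hv, ha⟩ := hx a ha
    exact mem_of_mem_map_val hv a ha
  rw [← List.map_append, map_mem_map_val]
  rcases hw with hw | ⟨u, -, b, hb, rfl⟩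
  · have := hN w hw
    rw [List.length_map] at hl
    omega
  · exact Or.inr ⟨x ++ u, trivial, b, hb, by simp⟩

/-- Ordered languages are closed under inverse renaming of letters. -/
theorem preimage_mem_ORD (h : L ∈ ORD.languages) {W : Type} (f : W → ℕ)
    (hf : ∀ a, ∃ v ∈ L, f a ∈ v) : ({w : List W | w.map f ∈ L} : Language W) ∈ ORD W := by
  obtain ⟨V, -, K, ⟨Z, i, j, M, hM, rfl⟩, rfl⟩ := h
  have hV : ∀ a, f a ∈ V := fun a => by
    obtain ⟨v, hv, ha⟩ := hf a
    exact mem_of_mem_map_val hv _ ha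
  refine ⟨Z, i, j, M.comap fun a => ⟨f a, hV a⟩, fun a => hM _, ?_⟩
  rw [DFA.accepts_comap]
  ext w
  change w.map _ ∈ M.accepts ↔ w.map f ∈ Language.map _ _
  rw [← map_mem_map_val, List.map_map]
  rfl

end Languages

/-! ### Finite languages, stars and comets -/

section Invariants

variable {V : Type}

theorem finite_kstar_iff {K : Language V} :
    Set.Finite ((K∗ : Language V) : Set (List V)) ↔ ∀ w ∈ K, w = [] := by
  constructor
  · intro h w hw
    obtain ⟨N, hN⟩ := exists_length_lt_of_finite h
    by_contra hne
    have := hN (wordPow w N) ⟨_, rfl, fun y hy => (List.mem_replicate.1 hy).2 ▸ hw⟩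
    rw [length_wordPow] at this
    have := List.length_pos_iff.2 hne
    nlinarith
  · intro h
    refine (Set.finite_singleton []).subset ?_
    rintro _ ⟨l, rfl, hl⟩
    exact List.flatten_eq_nil_iff.2 fun w hw => h w (hl w hw)

/-- A finite union-free language has at most one word: only closures of `∅` and `{λ}` are finite,
and without closure nothing creates a second word. -/
theorem IsUnionFree.subsingleton_of_finite {L : Language V} (h : IsUnionFree L)
    (hfin : Set.Finite (L : Set (List V))) : Set.Subsingleton (L : Set (List V)) := by
  induction h with
  | empty => exact Set.subsingleton_empty
  | letter a => exact Set.subsingleton_singleton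
  | @concat K L _ _ hK hL =>
    rintro _ ⟨x, hx, y, hy, rfl⟩ _ ⟨x', hx', y', hy', rfl⟩
    have h1 : Set.Finite (K : Set (List V)) :=
      Set.Finite.of_finite_image (f := (· ++ y)) (hfin.subset (by
        rintro _ ⟨u, hu, rfl⟩
        exact ⟨u, hu, y, hy, rfl⟩)) (List.append_left_injective y).injOn
    have h2 : Set.Finite (L : Set (List V)) :=
      Set.Finite.of_finite_image (f := (x ++ ·)) (hfin.subset (by
        rintro _ ⟨u, hu, rfl⟩
        exact ⟨x, hx, u, hu, rfl⟩)) (List.append_right_injective x).injOn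
    rw [hK h1 hx hx', hL h2 hy hy']
  | star _ _ =>
    have h := finite_kstar_iff.1 hfin
    rintro _ ⟨l, rfl, hl⟩ _ ⟨l', rfl, hl'⟩
    rw [List.flatten_eq_nil_iff.2 fun w hw => h w (hl w hw),
      List.flatten_eq_nil_iff.2 fun w hw => h w (hl' w hw)]

/-- A union-free language has at most one word of minimal length. -/
theorem IsUnionFree.exists_unique_shortest {L : Language V} (h : IsUnionFree L) :
    L = 0 ∨ ∃ w ∈ L, ∀ w' ∈ L, w' = w ∨ w.length < w'.length := by
  induction h with
  | empty => exact Or.inl rfl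
  | letter a => exact Or.inr ⟨[a], rfl, fun w' h => Or.inl h⟩
  | concat _ _ hK hL =>
    rcases hK with rfl | ⟨x, hx, hK⟩
    · exact Or.inl (zero_mul _)
    rcases hL with rfl | ⟨y, hy, hL⟩
    · exact Or.inl (mul_zero _)
    refine Or.inr ⟨x ++ y, ⟨x, hx, y, hy, rfl⟩, ?_⟩
    rintro _ ⟨x', hx', y', hy', rfl⟩
    simp only [List.length_append]
    rcases hK x' hx' with rfl | h
    · rcases hL y' hy' with rfl | h
      · exact Or.inl rfl
      · exact Or.inr (by omega)
    · rcases hL y' hy' with rfl | h'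
      · exact Or.inr (by omega)
      · exact Or.inr (by omega)
  | star _ _ =>
    refine Or.inr ⟨[], Language.nil_mem_kstar _, fun w' _ => ?_⟩
    by_cases h : w' = []
    · exact Or.inl h
    · exact Or.inr (List.length_pos_iff.2 h)

theorem exists_ne_nil_mem {G : Language V} (h0 : G ≠ 0) (h1 : G ≠ 1) : ∃ g ∈ G, g ≠ [] := by
  by_contra! h
  obtain ⟨g, hg⟩ := exists_mem_of_ne_zero h0
  refine h1 (Language.ext fun w => ⟨fun hw => h w hw, fun hw => ?_⟩)
  have hw' : w = [] := hw
  rwa [hw', ← h g hg]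

/-- A finite two-sided comet is empty. -/
theorem not_finite_of_mem_TCOM {L : Language ℕ} (h : L ∈ TCOM.languages) (h0 : L ≠ 0) :
    ¬ Set.Finite (L : Set (List ℕ)) := by
  obtain ⟨E, G, H, hG0, hG1, rfl⟩ := eq_of_mem_TCOM h
  intro hfin
  obtain ⟨_, _, ⟨e, he, _, -, rfl⟩, x, hx, rfl⟩ := exists_mem_of_ne_zero h0
  obtain ⟨g, hg, hne⟩ := exists_ne_nil_mem hG0 hG1
  refine hne (finite_kstar_iff.1 ?_ g hg)
  refine Set.Finite.of_finite_image (f := fun y => e ++ y ++ x) (hfin.subset ?_) ?_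
  · rintro _ ⟨y, hy, rfl⟩
    exact ⟨_, ⟨e, he, y, hy, rfl⟩, x, hx, rfl⟩
  · intro y _ y' _ h
    simpa using h

theorem mem_kstar_singleton {u w : List V} :
    w ∈ (({u} : Language V)∗) ↔ ∃ n, w = wordPow u n := by
  constructor
  · rintro ⟨l, rfl, hl⟩
    exact ⟨l.length, by rw [wordPow, ← List.eq_replicate_of_mem fun y hy => hl y hy]⟩
  · rintro ⟨n, rfl⟩
    exact ⟨_, rfl, fun y hy => (List.mem_replicate.1 hy).2⟩

theorem wordPow_pair (a : V) (n : ℕ) : wordPow [a, a] n = List.replicate (2 * n) a := by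
  induction n with
  | zero => rfl
  | succ n ih => rw [wordPow_succ, ih, mul_add, add_comm, List.replicate_add]; rfl

theorem replicate_append_cons_inj {a b : V} (hab : b ≠ a) {i j : ℕ} {x y : List V}
    (h : List.replicate i a ++ b :: x = List.replicate j a ++ b :: y) : i = j := by
  have h' := (wordsOver_append_cons_inj (B := {a}) (c := b) hab
    (fun _ h => (List.mem_replicate.1 h).2) (fun _ h => (List.mem_replicate.1 h).2) h).1
  simpa using congrArg List.length h'

end Invariants

/-! ### Witness languages -/

section Witnesses

/-- The alphabet of the letters `0, …, n - 1`. -/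
abbrev Letter (n : ℕ) : Type := {a : ℕ // a ∈ Finset.range n}

/-- The number `i < n` as a letter. -/
abbrev ltr {n : ℕ} (i : ℕ) (h : i < n := by decide) : Letter n := ⟨i, Finset.mem_range.2 h⟩

theorem mem_languages {X : Family} {n : ℕ} {K : Language (Letter n)} (h : K ∈ X (Letter n))
    (hn : 0 < n := by decide) : Language.map Subtype.val K ∈ X.languages :=
  ⟨Finset.range n, ⟨0, Finset.mem_range.2 hn⟩, K, h, rfl⟩

theorem singleton_ne_zero {V : Type} (w : List V) : ({w} : Language V) ≠ 0 :=
  Set.singleton_ne_empty w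

theorem one_mem_languages {X : Family} (h : (1 : Language (Letter 1)) ∈ X (Letter 1)) :
    (1 : Language ℕ) ∈ X.languages := by
  have h := mem_languages h
  rwa [map_one] at h

theorem singleton_mem_languages_FIN (w : List (Letter 2)) :
    {w.map Subtype.val} ∈ FIN.languages := by
  rw [← map_singleton]
  exact mem_languages (Set.finite_singleton w)

theorem FIN_not_subset_SUF : ¬ FIN.languages ⊆ SUF.languages := fun h => by
  have h' : [] ∈ ({[0]} : Language ℕ) := mem_of_append_mem_of_mem_SUF (x := [0])
    (h (singleton_mem_languages_FIN [ltr 0])) rfl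
  have : [] = [0] := h'
  simp at this

theorem FIN_not_subset_CIRC : ¬ FIN.languages ⊆ CIRC.languages := fun h => by
  have h' : [1, 0] ∈ ({[0, 1]} : Language ℕ) := append_comm_mem_of_mem_CIRC (x := [0]) (y := [1])
    (h (singleton_mem_languages_FIN [ltr 0, ltr 1])) rfl
  have : [1, 0] = [0, 1] := h'
  simp at this

/-- The language `{λ, a}` is not union-free. -/
theorem nil_or_letter_notMem_UF :
    Language.map Subtype.val (1 + {[ltr 0]} : Language (Letter 1)) ∉ UF.languages := by
  intro h
  have hfin : Set.Finite ((1 + {[ltr 0]} : Language (Letter 1)) : Set (List (Letter 1))) :=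
    (Set.finite_singleton []).union (Set.finite_singleton [ltr 0])
  have := (isUnionFree_of_mem_UF h).subsingleton_of_finite (hfin.image _)
    ⟨[], Or.inl rfl, rfl⟩ ⟨[ltr 0], Or.inr rfl, rfl⟩
  simp at this

theorem FIN_not_subset_UF : ¬ FIN.languages ⊆ UF.languages := fun h =>
  nil_or_letter_notMem_UF (h (mem_languages
    ((Set.finite_singleton []).union (Set.finite_singleton [ltr 0]))))

theorem one_notMem_TCOM : (1 : Language ℕ) ∉ TCOM.languages := fun h =>
  not_finite_of_mem_TCOM h (singleton_ne_zero []) (Set.finite_singleton [])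

theorem FIN_not_subset_TCOM : ¬ FIN.languages ⊆ TCOM.languages := fun h =>
  one_notMem_TCOM (h (one_mem_languages (Set.finite_singleton [])))

theorem MON_not_subset_FIN : ¬ MON.languages ⊆ FIN.languages := fun h => by
  obtain ⟨N, hN⟩ := exists_length_lt_of_finite
    (finite_of_mem_FIN (h (mem_languages (n := 1) (K := ⊤) rfl)))
  have : ((List.replicate N (ltr 0 : Letter 1)).map Subtype.val).length < N :=
    hN _ ⟨_, trivial, rfl⟩
  rw [List.length_map, List.length_replicate] at this
  exact lt_irrefl _ this

theorem MON_not_subset_COMB : ¬ MON.languages ⊆ COMB.languages := fun h =>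
  nil_notMem_of_mem_COMB (h (mem_languages (n := 1) (K := ⊤) rfl)) ⟨[], trivial, rfl⟩

/-- Membership in the combinational language `V* a` with `V = {a, b}`. -/
theorem mem_map_top_mul_letters {w : List ℕ} :
    w ∈ Language.map Subtype.val (⊤ * letters {ltr 0} : Language (Letter 2)) ↔
      ∃ v : List (Letter 2), w = v.map Subtype.val ++ [0] := by
  constructor
  · rintro ⟨_, ⟨v, -, _, ⟨_, rfl, rfl⟩, rfl⟩, rfl⟩
    exact ⟨v, by simp⟩
  · rintro ⟨v, rfl⟩
    exact ⟨_, ⟨v, trivial, _, ⟨_, rfl, rfl⟩, rfl⟩, by simp⟩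

theorem map_top_mul_letters_mem_COMB :
    Language.map Subtype.val (⊤ * letters {ltr 0} : Language (Letter 2)) ∈ COMB.languages :=
  mem_languages ⟨_, rfl⟩

theorem COMB_not_subset_SUF : ¬ COMB.languages ⊆ SUF.languages := fun h => by
  have h' := mem_of_append_mem_of_mem_SUF (x := [0]) (y := []) (h map_top_mul_letters_mem_COMB)
    (mem_map_top_mul_letters.2 ⟨[], rfl⟩)
  obtain ⟨v, hv⟩ := mem_map_top_mul_letters.1 h'
  simp at hv

theorem COMB_not_subset_CIRC : ¬ COMB.languages ⊆ CIRC.languages := fun h => by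
  have h' := append_comm_mem_of_mem_CIRC (x := [1]) (y := [0]) (h map_top_mul_letters_mem_COMB)
    (mem_map_top_mul_letters.2 ⟨[ltr 1], rfl⟩)
  obtain ⟨v, hv⟩ := mem_map_top_mul_letters.1 h'
  have := (List.append_inj' (s₁ := [0]) (t₁ := [1]) hv rfl).2
  simp at this

theorem COMB_not_subset_NIL : ¬ COMB.languages ⊆ NIL.languages := fun h => by
  rcases finite_or_of_mem_NIL (h map_top_mul_letters_mem_COMB) with h | ⟨N, hN⟩
  · obtain ⟨N, hN⟩ := exists_length_lt_of_finite h
    have := hN _ (mem_map_top_mul_letters.2 ⟨List.replicate N (ltr 0), rfl⟩)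
    simp at this
  · have h' := hN (List.replicate (N + 1) 1) (fun a ha => ⟨[1, 0],
      mem_map_top_mul_letters.2 ⟨[ltr 1], rfl⟩, by simp [(List.mem_replicate.1 ha).2]⟩) (by simp)
    obtain ⟨v, hv⟩ := mem_map_top_mul_letters.1 h'
    rw [List.replicate_succ'] at hv
    have := (List.append_inj' hv rfl).2
    simp at this

/-- Witnessed by the non-empty words over `{a, b}`, of which two have length one. -/
theorem COMB_not_subset_UF : ¬ COMB.languages ⊆ UF.languages := fun h => by
  have hK : Language.map Subtype.val (⊤ * letters Set.univ : Language (Letter 2)) ∈ UF.languages :=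
    h (mem_languages ⟨_, rfl⟩)
  have hmem : ∀ a : Letter 2, [a.1] ∈
      Language.map Subtype.val (⊤ * letters Set.univ : Language (Letter 2)) :=
    fun a => ⟨[a], ⟨[], trivial, [a], ⟨a, trivial, rfl⟩, rfl⟩, rfl⟩
  rcases (isUnionFree_of_mem_UF hK).exists_unique_shortest with h0 | ⟨w, hw, hmin⟩
  · have := hmem (ltr 0)
    rw [h0] at this
    exact this
  · have hl : w ≠ [] := by
      obtain ⟨_, ⟨v, -, _, ⟨a, -, rfl⟩, rfl⟩, rfl⟩ := hw
      simp
    have hl' := List.length_pos_iff.2 hl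
    have e0 := (hmin _ (hmem (ltr 0))).resolve_right (by simpa using hl)
    have e1 := (hmin _ (hmem (ltr 1))).resolve_right (by simpa using hl)
    have := e0.trans e1.symm
    simp at this

theorem one_mem_STAR (V : Type) : (1 : Language V) ∈ STAR V :=
  ⟨0, isRegular_zero, kstar_zero.symm⟩

theorem STAR_not_subset_TCOM : ¬ STAR.languages ⊆ TCOM.languages := fun h =>
  one_notMem_TCOM (h (one_mem_languages (one_mem_STAR _)))

/-- Witnessed by `(ab)*`. -/
theorem STAR_not_subset_CIRC : ¬ STAR.languages ⊆ CIRC.languages := fun h => by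
  have hK : ({[0, 1]} : Language ℕ)∗ ∈ STAR.languages := by
    have h := mem_languages (X := STAR) (K := ({[ltr 0, ltr 1]} : Language (Letter 2))∗)
      ⟨_, isRegular_singleton _, rfl⟩
    rwa [Language.map_kstar, map_singleton] at h
  obtain ⟨n, hn⟩ := mem_kstar_singleton.1 (append_comm_mem_of_mem_CIRC (x := [0]) (y := [1]) (h hK)
    (mem_kstar_singleton.2 ⟨1, rfl⟩))
  cases n with
  | zero => simp [wordPow_zero] at hn
  | succ n => simp [wordPow_succ] at hn

/-- The language `(aa)*` is not power-separating. -/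
theorem kstar_pair_notMem_PS : ({[0, 0]} : Language ℕ)∗ ∉ PS.languages := by
  intro h
  obtain ⟨m, hm⟩ := powers_of_mem_PS h
  have hmem : ∀ n, wordPow [0] n ∈ ({[0, 0]} : Language ℕ)∗ ↔ ∃ k, n = 2 * k := by
    intro n
    simp only [mem_kstar_singleton, wordPow_pair, wordPow_singleton]
    exact exists_congr fun k => ⟨fun h => by simpa using congrArg List.length h, fun h => h ▸ rfl⟩
  rcases hm [0] with h | h
  · exact h (2 * m) (by omega) ((hmem _).2 ⟨m, rfl⟩)
  · obtain ⟨k, hk⟩ := (hmem _).1 (h (2 * m + 1) (by omega))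
    omega

theorem kstar_pair_mem_languages {X : Family}
    (h : (({[ltr 0, ltr 0]} : Language (Letter 1))∗) ∈ X (Letter 1)) :
    ({[0, 0]} : Language ℕ)∗ ∈ X.languages := by
  have h := mem_languages h
  rwa [Language.map_kstar, map_singleton] at h

theorem STAR_not_subset_PS : ¬ STAR.languages ⊆ PS.languages := fun h =>
  kstar_pair_notMem_PS (h (kstar_pair_mem_languages ⟨_, isRegular_singleton _, rfl⟩))

theorem COMM_not_subset_PS : ¬ COMM.languages ⊆ PS.languages := fun h => by
  refine kstar_pair_notMem_PS (h (kstar_pair_mem_languages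
    ⟨isRegular_kstar (isRegular_singleton _), fun w w' hw hp => ?_⟩))
  obtain ⟨n, rfl⟩ := mem_kstar_singleton.1 hw
  rw [wordPow_pair] at hp
  exact mem_kstar_singleton.2 ⟨n, by rw [wordPow_pair, List.replicate_perm.1 hp]⟩

theorem singleton_cons_ne_one {V : Type} (a : V) (w : List V) :
    ({a :: w} : Language V) ≠ 1 := fun h => by
  have h' : a :: w ∈ (1 : Language V) := h ▸ rfl
  have h'' : a :: w = [] := h'
  simp at h''

theorem LCOM_not_subset_PS : ¬ LCOM.languages ⊆ PS.languages := fun h =>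
  kstar_pair_notMem_PS (h (kstar_pair_mem_languages ⟨1, _, isRegular_one, isRegular_singleton _,
    singleton_ne_zero _, singleton_cons_ne_one _ _, (one_mul _).symm⟩))

theorem RCOM_not_subset_PS : ¬ RCOM.languages ⊆ PS.languages := fun h =>
  kstar_pair_notMem_PS (h (kstar_pair_mem_languages ⟨_, 1, isRegular_singleton _, isRegular_one,
    singleton_ne_zero _, singleton_cons_ne_one _ _, (mul_one _).symm⟩))

theorem SUF_not_subset_UF : ¬ SUF.languages ⊆ UF.languages := fun h => by
  refine nil_or_letter_notMem_UF (h (mem_languages ⟨isRegular_one.add (isRegular_singleton _), ?_⟩))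
  rintro x y (hxy | hxy)
  · exact Or.inl (List.append_eq_nil_iff.1 hxy).2
  · have hxy' : x ++ y = [ltr 0] := hxy
    rcases List.append_eq_singleton_iff.1 hxy' with ⟨-, h⟩ | ⟨-, h⟩
    · exact Or.inr h
    · exact Or.inl h

theorem COMM_not_subset_UF : ¬ COMM.languages ⊆ UF.languages := fun h => by
  refine nil_or_letter_notMem_UF (h (mem_languages ⟨isRegular_one.add (isRegular_singleton _), ?_⟩))
  rintro w w' (hw | hw) hp
  · have hw' : w = [] := hw
    exact Or.inl (List.perm_nil.1 (hw' ▸ hp.symm))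
  · have hw' : w = [ltr 0] := hw
    exact Or.inr (List.perm_singleton.1 (hw' ▸ hp.symm))

theorem SUF_not_subset_TCOM : ¬ SUF.languages ⊆ TCOM.languages := fun h =>
  one_notMem_TCOM (h (one_mem_languages
    ⟨isRegular_one, fun _ _ h => (List.append_eq_nil_iff.1 h).2⟩))

theorem COMM_not_subset_TCOM : ¬ COMM.languages ⊆ TCOM.languages := fun h =>
  one_notMem_TCOM (h (one_mem_languages
    ⟨isRegular_one, fun w _ h hp => List.perm_nil.1 ((show w = [] from h) ▸ hp.symm)⟩))

/-- Witnessed by the set of suffixes of `ab`. -/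
theorem SUF_not_subset_CIRC : ¬ SUF.languages ⊆ CIRC.languages := fun h => by
  let K : Language (Letter 2) := {w : List (Letter 2) | w <:+ [ltr 0, ltr 1]}
  have hK : K ∈ SUF (Letter 2) := by
    refine ⟨isRegular_of_finite ?_, fun x y h => (List.suffix_append x y).trans h⟩
    refine ([ltr 0, ltr 1] : List (Letter 2)).tails.finite_toSet.subset fun w hw => ?_
    exact (List.mem_tails _ _).2 hw
  obtain ⟨v, hv, h'⟩ := append_comm_mem_of_mem_CIRC (x := [0]) (y := [1]) (h (mem_languages hK))
    ⟨[ltr 0, ltr 1], List.suffix_refl _, rfl⟩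
  have hv' : v = [ltr 0, ltr 1] := List.IsSuffix.eq_of_length hv (by
    simpa using congrArg List.length h')
  subst hv'
  simp at h'

/-- The language `a* ∪ b(aa)*` is suffix-closed and counts modulo two. -/
theorem SUF_not_subset_NC : ¬ SUF.languages ⊆ NC.languages := fun h => by
  let K : Language (Letter 2) := {[ltr 0]}∗ + {[ltr 1]} * {[ltr 0, ltr 0]}∗
  have hK : K ∈ SUF (Letter 2) := by
    refine ⟨(isRegular_kstar (isRegular_singleton _)).add
      (isRegular_mul (isRegular_singleton _) (isRegular_kstar (isRegular_singleton _))), ?_⟩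
    have key : ∀ n (x y : List (Letter 2)), x ++ y = List.replicate n (ltr 0) → y ∈ K := by
      intro n x y hxy
      have := (List.append_eq_replicate_iff.1 hxy).2.2
      exact Or.inl (mem_kstar_singleton.2 ⟨y.length, by rw [wordPow_singleton, ← this]⟩)
    rintro x y (hxy | ⟨_, rfl, v, hv, hxy⟩)
    · obtain ⟨n, hn⟩ := mem_kstar_singleton.1 hxy
      exact key n x y (by rw [hn, wordPow_singleton])
    · obtain ⟨n, rfl⟩ := mem_kstar_singleton.1 hv
      cases x with
      | nil =>
        refine Or.inr ⟨_, rfl, _, hv, hxy⟩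
      | cons a x =>
        simp only [List.cons_append, List.nil_append, List.cons.injEq] at hxy
        exact key _ x y (by rw [← hxy.2, wordPow_pair])
  have hL := mem_languages hK
  simp only [K, map_add, map_mul, Language.map_kstar, map_singleton, List.map_cons,
    List.map_nil] at hL
  obtain ⟨k, hk⟩ := noncounting_of_mem_NC (h hL)
  have hmem : ∀ n, [1] ++ wordPow [0] n ++ [] ∈
      ({[0]}∗ + {[1]} * {[0, 0]}∗ : Language ℕ) ↔ ∃ i, n = 2 * i := by
    intro n
    constructor
    · rintro (h | ⟨_, rfl, v, hv, h⟩)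
      · obtain ⟨j, hj⟩ := mem_kstar_singleton.1 h
        have : 1 ∈ wordPow [0] j := hj ▸ by simp
        simpa using mem_wordPow this
      · obtain ⟨i, rfl⟩ := mem_kstar_singleton.1 hv
        refine ⟨i, ?_⟩
        have := congrArg List.length h
        simp [length_wordPow] at this
        omega
    · rintro ⟨i, rfl⟩
      exact Or.inr ⟨_, rfl, _, mem_kstar_singleton.2 ⟨i, rfl⟩,
        by simp [wordPow_singleton, wordPow_pair]⟩
  have := hk [1] [0] []
  rw [hmem, hmem] at this
  rcases Nat.even_or_odd' k with ⟨i, rfl | rfl⟩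
  · obtain ⟨j, hj⟩ := this.1 ⟨i, rfl⟩
    omega
  · obtain ⟨j, hj⟩ := this.2 ⟨i + 1, by ring⟩
    omega

/-- Witnessed by the set of circular shifts of `abc`. -/
theorem CIRC_not_subset_COMM : ¬ CIRC.languages ⊆ COMM.languages := fun h => by
  let K : Language (Letter 3) := {w : List (Letter 3) | w ~r [ltr 0, ltr 1, ltr 2]}
  have hK : K ∈ CIRC (Letter 3) := by
    refine ⟨isRegular_of_finite ?_, fun u v h => List.IsRotated.trans ?_ h⟩
    · refine (List.cyclicPermutations [ltr 0, ltr 1, ltr 2]).finite_toSet.subset fun w hw => ?_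
      exact List.mem_cyclicPermutations_iff.2 hw
    · exact List.isRotated_append
  obtain ⟨v, hv, h'⟩ := perm_mem_of_mem_COMM (w := [0, 1, 2]) (w' := [0, 2, 1])
    (h (mem_languages hK)) ⟨_, List.IsRotated.refl _, rfl⟩ (by decide)
  have h2 : ([0, 2, 1] : List ℕ) ~r [0, 1, 2] := h' ▸ List.IsRotated.map hv Subtype.val
  exact absurd h2 (by decide)

theorem UF_not_subset_STAR : ¬ UF.languages ⊆ STAR.languages := fun h =>
  nil_mem_of_mem_STAR (h (mem_languages (n := 1) (K := 0) .empty)) |>.elim fun _ h => h.1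

/-- The language `b(aa)*bV*` with `V = {a, b}` counts modulo two. -/
theorem SYDEF_not_subset_NC : ¬ SYDEF.languages ⊆ NC.languages := fun h => by
  let E : Language (Letter 2) := {[ltr 1]} * {[ltr 0, ltr 0]}∗ * {[ltr 1]}
  have hE : E.IsRegular := isRegular_mul (isRegular_mul (isRegular_singleton _)
    (isRegular_kstar (isRegular_singleton _))) (isRegular_singleton _)
  have hL : Language.map Subtype.val (E * ⊤ * 1) ∈ SYDEF.languages :=
    mem_languages ⟨E, 1, hE, isRegular_one, rfl⟩
  simp only [E, mul_one, map_mul, Language.map_kstar, map_singleton, List.map_cons,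
    List.map_nil] at hL
  obtain ⟨k, hk⟩ := noncounting_of_mem_NC (h hL)
  have hmem : ∀ n, [1] ++ wordPow [0] n ++ [1] ∈
      ({[1]} * {[0, 0]}∗ * {[1]} * Language.map (Subtype.val : Letter 2 → ℕ) ⊤ : Language ℕ) ↔
      ∃ i, n = 2 * i := by
    intro n
    constructor
    · rintro ⟨_, ⟨_, ⟨_, rfl, v, hv, rfl⟩, _, rfl, rfl⟩, x, -, h⟩
      obtain ⟨i, rfl⟩ := mem_kstar_singleton.1 hv
      refine ⟨i, (replicate_append_cons_inj (a := 0) (b := 1) (x := x) (y := []) (by simp) ?_).symm⟩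
      simpa [wordPow_pair, wordPow_singleton] using h
    · rintro ⟨i, rfl⟩
      exact ⟨_, ⟨_, ⟨_, rfl, _, mem_kstar_singleton.2 ⟨i, rfl⟩, rfl⟩, _, rfl, rfl⟩, [],
        ⟨[], trivial, rfl⟩, by simp [wordPow_singleton, wordPow_pair]⟩
  have := hk [1] [0] [1]
  rw [hmem, hmem] at this
  rcases Nat.even_or_odd' k with ⟨i, rfl | rfl⟩
  · obtain ⟨j, hj⟩ := this.1 ⟨i, rfl⟩
    omega
  · obtain ⟨j, hj⟩ := this.2 ⟨i + 1, by ring⟩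
    omega

/-- The language `b a*` is no right-sided comet. -/
theorem LCOM_not_subset_RCOM : ¬ LCOM.languages ⊆ RCOM.languages := fun h => by
  have hL : ({[1]} * {[0]}∗ : Language ℕ) ∈ LCOM.languages := by
    have h := mem_languages (X := LCOM) (K := ({[ltr 1]} * {[ltr 0]}∗ : Language (Letter 2)))
      ⟨_, _, isRegular_singleton _, isRegular_singleton _, singleton_ne_zero _,
        singleton_cons_ne_one _ _, rfl⟩
    rwa [map_mul, Language.map_kstar, map_singleton, map_singleton] at h
  obtain ⟨G, H, hG0, hG1, e⟩ := eq_of_mem_RCOM (h hL)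
  obtain ⟨g, hg, hne⟩ := exists_ne_nil_mem hG0 hG1
  have hne0 : [1] ∈ ({[1]} * {[0]}∗ : Language ℕ) := ⟨[1], rfl, [], Language.nil_mem_kstar _, rfl⟩
  rw [e] at hne0
  obtain ⟨_, -, x, hx, -⟩ := hne0
  have hmem : ∀ n, ∃ j, wordPow g n ++ x = 1 :: List.replicate j 0 := by
    intro n
    have h' : wordPow g n ++ x ∈ ({[1]} * {[0]}∗ : Language ℕ) :=
      e ▸ ⟨_, ⟨_, rfl, fun y hy => (List.mem_replicate.1 hy).2 ▸ hg⟩, x, hx, rfl⟩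
    obtain ⟨_, rfl, v, hv, h'⟩ := h'
    obtain ⟨j, rfl⟩ := mem_kstar_singleton.1 hv
    exact ⟨j, by rw [← h', wordPow_singleton]; rfl⟩
  obtain ⟨i, hi⟩ := hmem 1
  obtain ⟨j, hj⟩ := hmem 2
  cases g with
  | nil => exact hne rfl
  | cons a g =>
    rw [wordPow_one, List.cons_append, List.cons.injEq] at hi
    obtain ⟨rfl, -⟩ := hi
    simp only [wordPow_succ, wordPow_zero, List.cons_append, List.cons.injEq, true_and] at hj
    have : 1 ∈ List.replicate j 0 := hj ▸ by simp
    simpa using List.mem_replicate.1 this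

/-- The language `a* b` is no left-sided comet. -/
theorem RCOM_not_subset_LCOM : ¬ RCOM.languages ⊆ LCOM.languages := fun h => by
  have hL : ({[0]}∗ * {[1]} : Language ℕ) ∈ RCOM.languages := by
    have h := mem_languages (X := RCOM) (K := ({[ltr 0]}∗ * {[ltr 1]} : Language (Letter 2)))
      ⟨_, _, isRegular_singleton _, isRegular_singleton _, singleton_ne_zero _,
        singleton_cons_ne_one _ _, rfl⟩
    rwa [map_mul, Language.map_kstar, map_singleton, map_singleton] at h
  obtain ⟨E, G, hG0, hG1, e⟩ := eq_of_mem_LCOM (h hL)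
  obtain ⟨g, hg, hne⟩ := exists_ne_nil_mem hG0 hG1
  have hne0 : [1] ∈ ({[0]}∗ * {[1]} : Language ℕ) := ⟨[], Language.nil_mem_kstar _, [1], rfl, rfl⟩
  rw [e] at hne0
  obtain ⟨x, hx, -⟩ := hne0
  have hmem : ∀ n, ∃ j, x ++ wordPow g n = List.replicate j 0 ++ [1] := by
    intro n
    have h' : x ++ wordPow g n ∈ ({[0]}∗ * {[1]} : Language ℕ) :=
      e ▸ ⟨x, hx, _, ⟨_, rfl, fun y hy => (List.mem_replicate.1 hy).2 ▸ hg⟩, rfl⟩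
    obtain ⟨v, hv, _, rfl, h'⟩ := h'
    obtain ⟨j, rfl⟩ := mem_kstar_singleton.1 hv
    exact ⟨j, by rw [← h', wordPow_singleton]⟩
  obtain ⟨i, hi⟩ := hmem 1
  obtain ⟨j, hj⟩ := hmem 2
  rcases List.eq_nil_or_concat g with rfl | ⟨g, a, rfl⟩
  · exact hne rfl
  · rw [wordPow_one, List.concat_eq_append, ← List.append_assoc] at hi
    have h1 := (List.append_inj' hi rfl).2
    simp only [List.cons.injEq, and_true] at h1
    subst h1
    simp only [wordPow_succ, wordPow_zero, List.concat_eq_append, List.append_nil,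
      ← List.append_assoc] at hj
    have h2 := (List.append_inj' hj rfl).1
    have : 1 ∈ List.replicate j 0 := h2 ▸ by simp
    simpa using List.mem_replicate.1 this

end Witnesses

/-! ### Witness languages for the ordered family -/

section OrderedWitnesses

/-- An ordered automaton for `a V*` with `V = {a, b}`: the states are `0` (dead), `1` (initial)
and `2` (accepting). -/
def headDFA : DFA (Letter 2) (Fin 3) where
  step s a := if s = 1 then (if a.1 = 0 then 2 else 0) else s
  start := 1
  accept := {2}

theorem headDFA_accepts (a : Letter 2) (w : List (Letter 2)) :
    a :: w ∈ headDFA.accepts ↔ a.1 = 0 := by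
  have hfix : ∀ (w : List (Letter 2)) (s : Fin 3), s ≠ 1 → headDFA.evalFrom s w = s := by
    intro w
    induction w with
    | nil => exact fun _ _ => rfl
    | cons a w ih =>
      intro s hs
      rw [DFA.evalFrom_cons, show headDFA.step s a = s from if_neg hs, ih s hs]
  rw [DFA.mem_accepts, DFA.eval, DFA.evalFrom_cons]
  by_cases ha : a.1 = 0
  · rw [show headDFA.step headDFA.start a = 2 from if_pos ha, hfix _ _ (by decide)]
    exact iff_of_true rfl ha
  · rw [show headDFA.step headDFA.start a = 0 from if_neg ha, hfix _ _ (by decide)]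
    exact iff_of_false (by simp [headDFA]) ha

/-- In a definite language, long words could be extended to the left; no word of `a V*` can be
extended by `b`. -/
theorem ORD_not_subset_DEF : ¬ ORD.languages ⊆ DEF.languages := fun h => by
  have hK : headDFA.accepts ∈ ORD (Letter 2) := by
    refine ⟨Fin 3, inferInstance, inferInstance, headDFA, fun a z z' hz => ?_, rfl⟩
    have key : ∀ c : Fin 3, c = 0 ∨ c = 2 → ∀ z z' : Fin 3, z ≤ z' →
        (if z = 1 then c else z) ≤ (if z' = 1 then c else z') := by decide
    exact key (if a.1 = 0 then 2 else 0) (by split_ifs <;> simp) z z' hz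
  obtain ⟨N, hN⟩ := append_mem_of_mem_DEF (h (mem_languages hK))
  have hmem : ∀ v : List (Letter 2), (ltr 0 :: v).map Subtype.val ∈
      Language.map Subtype.val headDFA.accepts := fun v =>
    map_mem_map_val.2 ((headDFA_accepts _ _).2 rfl)
  have h' := hN [1] (fun a ha => ⟨_, hmem [ltr 1], by simp_all⟩) _
    (hmem (List.replicate N (ltr 1))) (by simp)
  have h2 : (ltr 1 :: ltr 0 :: List.replicate N (ltr 1) : List (Letter 2)).map Subtype.val ∈
    Language.map Subtype.val headDFA.accepts := h'
  rw [map_mem_map_val, headDFA_accepts] at h2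
  simp at h2

/-- The transitions of `swapDFA` below, on all numbers as letters. -/
def swapStep (s : Fin 5) (a : ℕ) : Fin 5 :=
  if s = 0 ∧ a = 0 then 1 else if s = 0 ∧ a = 1 then 3 else
  if s = 2 ∧ a = 0 then 3 else if s = 2 ∧ a = 1 then 1 else
  if s = 1 ∧ a = 2 then 0 else if s = 3 ∧ a = 3 then 2 else 4

/-- An automaton with the transitions `0 -a→ 1`, `0 -b→ 3`, `2 -a→ 3`, `2 -b→ 1`, `1 -c→ 0`,
`3 -d→ 2` and the dead state `4`; the state `0` is initial and accepting. The letters `a` and `b`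
map the pair of states `0, 2` to the pair `1, 3` in the two different ways. -/
def swapDFA : DFA (Letter 4) (Fin 5) where
  step s a := swapStep s a.1
  start := 0
  accept := {0}

theorem swapDFA_evalFrom_dead (w : List (Letter 4)) : swapDFA.evalFrom 4 w = 4 := by
  induction w with
  | nil => rfl
  | cons a w ih =>
    rw [DFA.evalFrom_cons, show swapDFA.step 4 a = 4 by simp [swapDFA, swapStep], ih]

/-- A word of length at least two is defined on at most one state other than the dead one. -/
theorem swapDFA_rank (a b : Letter 4) (w : List (Letter 4)) :
    ∃ s, ∀ t, t ≠ s → swapDFA.evalFrom t (a :: b :: w) = 4 := by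
  have key : ∀ a < 4, ∀ b < 4, ∃ s : Fin 5, ∀ t, t ≠ s → swapStep (swapStep t a) b = 4 := by
    decide
  obtain ⟨s, hs⟩ := key a.1 (Finset.mem_range.1 a.2) b.1 (Finset.mem_range.1 b.2)
  refine ⟨s, fun t ht => ?_⟩
  rw [DFA.evalFrom_cons, DFA.evalFrom_cons]
  change swapDFA.evalFrom (swapStep (swapStep t a.1) b.1) w = 4
  rw [hs t ht, swapDFA_evalFrom_dead]

theorem swapDFA_evalFrom_sq (y : List (Letter 4)) (s : Fin 5) :
    swapDFA.evalFrom s (wordPow y 2) = swapDFA.evalFrom s (wordPow y 3) := by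
  simp only [evalFrom_wordPow, Function.iterate_succ_apply, Function.iterate_zero_apply]
  match y with
  | [] => rfl
  | [a] =>
    have key : ∀ a < 4, ∀ s : Fin 5, swapStep (swapStep s a) a = 4 := by decide
    have h := key a.1 (Finset.mem_range.1 a.2) s
    change swapStep (swapStep s a.1) a.1 = swapStep (swapStep (swapStep s a.1) a.1) a.1
    rw [h]
    simp [swapStep]
  | a :: b :: w =>
    obtain ⟨r, hr⟩ := swapDFA_rank a b w
    have h4 := swapDFA_evalFrom_dead (a :: b :: w)
    by_cases h1 : swapDFA.evalFrom s (a :: b :: w) = r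
    · by_cases hs : s = r
      · subst hs
        rw [h1, h1, h1]
      · rw [hr s hs, h4, h4]
    · rw [hr _ h1, h4]

theorem swapDFA_accepts_mem_NC : swapDFA.accepts ∈ NC (Letter 4) := by
  refine ⟨⟨_, inferInstance, swapDFA, rfl⟩, 2, by omega, fun x y z => ?_⟩
  simp only [DFA.mem_accepts, DFA.eval, DFA.evalFrom_of_append, swapDFA_evalFrom_sq]

/-- In a linear order, two maps `a` and `b` cannot connect a pair of distinct points `p`, `q` to
the same pair of points in both ways, even if the images are only separated by monotone maps `u`
and `v` that return to `p` and to `q`. -/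
theorem false_of_swap {Z : Type} [LinearOrder Z] {a b u v : Z → Z} (ha : Monotone a)
    (hb : Monotone b) (hu : Monotone u) (hv : Monotone v) {p q : Z} (hpq : p < q)
    (h1 : u (a p) = p) (h2 : u (b q) = p) (h3 : v (b p) = q) (h4 : v (a q) = q)
    (h5 : u (b p) ≠ p) (h6 : v (a p) ≠ q) : False := by
  have hlt1 : b p < a p := by
    by_contra h
    have e1 := hu (not_lt.1 h)
    have e2 := hu (hb hpq.le)
    rw [h1] at e1
    rw [h2] at e2
    exact h5 (le_antisymm e2 e1)
  have hlt2 : a p < b p := by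
    by_contra h
    have e1 := hv (not_lt.1 h)
    have e2 := hv (ha hpq.le)
    rw [h3] at e1
    rw [h4] at e2
    exact h6 (le_antisymm e2 e1)
  exact lt_asymm hlt1 hlt2

/-- The language of `swapDFA` is not ordered. In an ordered automaton, reading a large power of a
word leads to a state fixed by that word. This gives two states that play the roles of `0` and
`2`, and these states contradict `false_of_swap`. -/
theorem swapDFA_accepts_notMem_ORD : swapDFA.accepts ∉ ORD (Letter 4) := by
  rintro ⟨Z, _, _, M, hM, hacc⟩
  have hmono : ∀ w : List (Letter 4), Monotone fun s => M.evalFrom s w := by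
    intro w
    induction w with
    | nil => exact monotone_id
    | cons a w ih => exact fun s t h => ih (hM a s t h)
  let N := Fintype.card Z
  have hstab : ∀ w s, M.evalFrom (M.evalFrom s (wordPow w N)) w = M.evalFrom s (wordPow w N) := by
    intro w s
    rw [evalFrom_wordPow, ← Function.iterate_succ_apply' (fun t => M.evalFrom t w),
      ← iterate_card_eq_of_monotone _ s (hmono w) le_rfl]
  let a : List (Letter 4) := [ltr 0]
  let b : List (Letter 4) := [ltr 1]
  -- `u` leads from the image `1` back to `0`, and `v` leads from the image `3` back to `2`.
  let u : List (Letter 4) := ltr 2 :: wordPow [ltr 0, ltr 2] N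
  let v : List (Letter 4) := ltr 3 :: wordPow [ltr 0, ltr 3] N
  let x : List (Letter 4) := wordPow (b ++ v ++ (b ++ u)) N
  let p := M.eval x
  let q := M.evalFrom p (b ++ v)
  have hu : ∀ s, M.evalFrom (M.evalFrom (M.evalFrom s u) a) u = M.evalFrom s u := by
    intro s
    have h := hstab [ltr 0, ltr 2] (M.step s (ltr 2))
    have h' : ∀ n, (fun t => M.evalFrom t [ltr 0, ltr 2])^[n] (M.evalFrom s u) =
        M.evalFrom s u := fun n => Function.iterate_fixed h n
    have := h' (N + 1)
    rwa [← evalFrom_wordPow, wordPow_succ] at this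
  have hv : ∀ s, M.evalFrom (M.evalFrom (M.evalFrom s v) a) v = M.evalFrom s v := by
    intro s
    have h := hstab [ltr 0, ltr 3] (M.step s (ltr 3))
    have h' : ∀ n, (fun t => M.evalFrom t [ltr 0, ltr 3])^[n] (M.evalFrom s v) =
        M.evalFrom s v := fun n => Function.iterate_fixed h n
    have := h' (N + 1)
    rwa [← evalFrom_wordPow, wordPow_succ] at this
  have hqp : M.evalFrom q (b ++ u) = p := by
    have h := hstab (b ++ v ++ (b ++ u)) M.start
    rwa [DFA.evalFrom_of_append] at h
  -- The accepting behaviour of the two states is the one of `0` and `2` in `swapDFA`.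
  have Tu : swapDFA.evalFrom 1 u = 0 := by
    change swapDFA.evalFrom 0 (wordPow _ N) = 0
    rw [evalFrom_wordPow]
    exact Function.iterate_fixed (by decide) N
  have Tv : swapDFA.evalFrom 3 v = 2 := by
    change swapDFA.evalFrom 2 (wordPow _ N) = 2
    rw [evalFrom_wordPow]
    exact Function.iterate_fixed (by decide) N
  have Tu' : swapDFA.evalFrom 3 u = 4 := swapDFA_evalFrom_dead _
  have Tv' : swapDFA.evalFrom 1 v = 4 := swapDFA_evalFrom_dead _
  have Tbv : swapDFA.evalFrom 0 (b ++ v) = 2 := Tv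
  have Tbu : swapDFA.evalFrom 2 (b ++ u) = 0 := Tu
  have Tx : swapDFA.eval x = 0 := by
    rw [DFA.eval, evalFrom_wordPow]
    refine Function.iterate_fixed ?_ N
    change swapDFA.evalFrom 0 (b ++ v ++ (b ++ u)) = 0
    rw [DFA.evalFrom_of_append, Tbv, Tbu]
  have hp : ∀ w, M.evalFrom p w ∈ M.accept ↔ swapDFA.evalFrom 0 w = 0 := by
    intro w
    have h : x ++ w ∈ M.accepts ↔ x ++ w ∈ swapDFA.accepts := by rw [hacc]
    rw [DFA.mem_accepts, DFA.mem_accepts, DFA.eval, DFA.eval, DFA.evalFrom_of_append,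
      DFA.evalFrom_of_append] at h
    rw [show swapDFA.evalFrom swapDFA.start x = 0 from Tx] at h
    exact h
  have hq : ∀ w, M.evalFrom q w ∈ M.accept ↔ swapDFA.evalFrom 2 w = 0 := by
    intro w
    have h := hp (b ++ v ++ w)
    rwa [DFA.evalFrom_of_append, DFA.evalFrom_of_append _ 0, Tbv] at h
  have hpa : p ∈ M.accept := (hp []).2 rfl
  have hqu : M.evalFrom q (b ++ u) ∈ M.accept := (hq _).2 Tbu
  have h1 : M.evalFrom (M.evalFrom p a) u = p := by
    rw [← hqp, DFA.evalFrom_of_append]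
    exact hu _
  have h2 : M.evalFrom (M.evalFrom q b) u = p := by rw [← DFA.evalFrom_of_append, hqp]
  have h3 : M.evalFrom (M.evalFrom p b) v = q := (DFA.evalFrom_of_append _ _ _ _).symm
  have h4 : M.evalFrom (M.evalFrom q a) v = q := by
    change M.evalFrom (M.evalFrom (M.evalFrom p (b ++ v)) a) v = M.evalFrom p (b ++ v)
    rw [DFA.evalFrom_of_append]
    exact hv _
  have h5 : M.evalFrom (M.evalFrom p b) u ≠ p := by
    intro h
    have := (hp (b ++ u)).1 (by rw [DFA.evalFrom_of_append, h]; exact hpa)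
    rw [DFA.evalFrom_of_append, show swapDFA.evalFrom 0 b = 3 by decide, Tu'] at this
    simp at this
  have h6 : M.evalFrom (M.evalFrom p a) v ≠ q := by
    intro h
    have := (hp (a ++ v ++ (b ++ u))).1 (by
      rw [DFA.evalFrom_of_append, DFA.evalFrom_of_append M p, h]; exact hqu)
    rw [DFA.evalFrom_of_append, DFA.evalFrom_of_append _ 0, show swapDFA.evalFrom 0 a = 1 by decide,
      Tv', swapDFA_evalFrom_dead] at this
    simp at this
  have h7 : M.evalFrom (M.evalFrom q a) u ≠ p := by
    intro h
    have := (hq (a ++ u)).1 (by rw [DFA.evalFrom_of_append, h]; exact hpa)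
    rw [DFA.evalFrom_of_append, show swapDFA.evalFrom 2 a = 3 by decide, Tu'] at this
    simp at this
  have h8 : M.evalFrom (M.evalFrom q b) v ≠ q := by
    intro h
    have := (hq (b ++ v ++ (b ++ u))).1 (by
      rw [DFA.evalFrom_of_append, DFA.evalFrom_of_append M q, h]; exact hqu)
    rw [DFA.evalFrom_of_append, DFA.evalFrom_of_append _ 2, show swapDFA.evalFrom 2 b = 1 by decide,
      Tv', swapDFA_evalFrom_dead] at this
    simp at this
  rcases lt_trichotomy p q with h | h | h
  · exact false_of_swap (hmono a) (hmono b) (hmono u) (hmono v) h h1 h2 h3 h4 h5 h6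
  · have h' := (hq []).1 (h ▸ hpa)
    simp at h'
  · exact false_of_swap (hmono a) (hmono b) (hmono v) (hmono u) h h4 h3 h2 h1 h8 h7

theorem NC_not_subset_ORD : ¬ NC.languages ⊆ ORD.languages := fun h => by
  refine swapDFA_accepts_notMem_ORD ?_
  have key := preimage_mem_ORD (h (mem_languages swapDFA_accepts_mem_NC)) (W := Letter 4)
    Subtype.val ?_
  · rwa [show swapDFA.accepts = {w : List (Letter 4) | w.map Subtype.val ∈
      Language.map Subtype.val swapDFA.accepts} from
      Language.ext fun w => map_mem_map_val.symm]
  · -- The words `ac` and `bdbc` are accepted.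
    intro a
    have h1 : ([ltr 0, ltr 2] : List (Letter 4)) ∈ swapDFA.accepts := by
      change swapDFA.eval _ = 0
      decide
    have h2 : ([ltr 1, ltr 3, ltr 1, ltr 2] : List (Letter 4)) ∈ swapDFA.accepts := by
      change swapDFA.eval _ = 0
      decide
    have ha := Finset.mem_range.1 a.2
    have : a.1 = 0 ∨ a.1 = 2 ∨ a.1 = 1 ∨ a.1 = 3 := by omega
    rcases this with h | h | h | h
    · exact ⟨_, ⟨_, h1, rfl⟩, by simp [h]⟩
    · exact ⟨_, ⟨_, h1, rfl⟩, by simp [h]⟩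
    · exact ⟨_, ⟨_, h2, rfl⟩, by simp [h]⟩
    · exact ⟨_, ⟨_, h2, rfl⟩, by simp [h]⟩

end OrderedWitnesses

/-! ### The diagram -/

section Diagram

/-- The targets of the arrows from a node. -/
def Node.succ : Node → List Node
  | .fin => [.nil]
  | .mon => [.star, .sydef, .comm, .nil, .suf]
  | .nil => [.def_]
  | .comb => [.def_, .sydef]
  | .def_ => [.ord]
  | .sydef => [.ps, .lcom, .rcom]
  | .suf => [.ps]
  | .ord => [.nc]
  | .nc => [.ps]
  | .ps => [.reg]
  | .comm => [.circ]
  | .circ => [.reg]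
  | .uf => [.reg]
  | .star => [.uf]
  | .lcom => [.tcom]
  | .rcom => [.tcom]
  | .tcom => [.reg]
  | .reg => []

theorem Node.arrow_of_mem_succ : ∀ {X Y : Node}, Y ∈ X.succ → Arrow X Y := by
  intro X Y h
  cases X <;> cases Y <;> first | constructor | simp [Node.succ] at h

/-- The nodes that can be reached from a node along at most `n` arrows. -/
def Node.reach : ℕ → Node → List Node
  | 0, X => [X]
  | n + 1, X => X :: X.succ.flatMap (Node.reach n)

theorem Node.directedPath_of_mem_reach {n : ℕ} {X Y : Node} (h : Y ∈ X.reach n) :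
    DirectedPath X Y := by
  induction n generalizing X with
  | zero =>
    rw [List.mem_singleton.1 h]
    exact .refl
  | succ n ih =>
    rcases List.mem_cons.1 h with rfl | h
    · exact .refl
    · obtain ⟨Z, hZ, h⟩ := List.mem_flatMap.1 h
      exact .head (Node.arrow_of_mem_succ hZ) (ih h)

/-- A number for each node, through which equality of nodes is decided. -/
def Node.toNat : Node → ℕ
  | .fin => 0 | .mon => 1 | .nil => 2 | .comb => 3 | .def_ => 4 | .sydef => 5 | .suf => 6
  | .ord => 7 | .nc => 8 | .ps => 9 | .comm => 10 | .circ => 11 | .uf => 12 | .star => 13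
  | .lcom => 14 | .rcom => 15 | .tcom => 16 | .reg => 17

instance : DecidableEq Node := fun X Y =>
  decidable_of_iff (X.toNat = Y.toNat)
    ⟨fun h => by cases X <;> cases Y <;> first | rfl | simp [Node.toNat] at h, fun h => h ▸ rfl⟩

/-- Pairs of nodes for which a witness language shows that the first family is not included in the
second. All other non-inclusions follow from these along the arrows. -/
def separations : List (Node × Node) :=
  [(.fin, .suf), (.fin, .circ), (.fin, .uf), (.fin, .tcom), (.mon, .fin), (.mon, .comb),
   (.comb, .suf), (.comb, .circ), (.comb, .uf), (.comb, .nil), (.star, .circ), (.star, .ps),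
   (.star, .tcom), (.suf, .uf), (.suf, .circ), (.suf, .nc), (.suf, .tcom), (.comm, .uf),
   (.comm, .ps), (.comm, .tcom), (.circ, .comm), (.uf, .star), (.sydef, .nc), (.ord, .def_),
   (.nc, .ord), (.lcom, .rcom), (.lcom, .ps), (.rcom, .lcom), (.rcom, .ps)]

theorem not_subset_of_mem_separations {p : Node × Node} (h : p ∈ separations) :
    ¬ p.1.family.languages ⊆ p.2.family.languages := by
  simp only [separations, List.mem_cons, List.not_mem_nil, or_false] at h
  rcases h with rfl | rfl | rfl | rfl | rfl | rfl | rfl | rfl | rfl | rfl | rfl | rfl | rfl | rfl |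
    rfl | rfl | rfl | rfl | rfl | rfl | rfl | rfl | rfl | rfl | rfl | rfl | rfl | rfl | rfl
  exacts [FIN_not_subset_SUF, FIN_not_subset_CIRC, FIN_not_subset_UF, FIN_not_subset_TCOM,
    MON_not_subset_FIN, MON_not_subset_COMB, COMB_not_subset_SUF, COMB_not_subset_CIRC,
    COMB_not_subset_UF, COMB_not_subset_NIL, STAR_not_subset_CIRC, STAR_not_subset_PS,
    STAR_not_subset_TCOM, SUF_not_subset_UF, SUF_not_subset_CIRC, SUF_not_subset_NC,
    SUF_not_subset_TCOM, COMM_not_subset_UF, COMM_not_subset_PS, COMM_not_subset_TCOM,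
    CIRC_not_subset_COMM, UF_not_subset_STAR, SYDEF_not_subset_NC, ORD_not_subset_DEF,
    NC_not_subset_ORD, LCOM_not_subset_RCOM, LCOM_not_subset_PS, RCOM_not_subset_LCOM,
    RCOM_not_subset_PS]

theorem languages_subset {X Y : Family}
    (h : ∀ (V : Type) [Finite V] [Nonempty V], X V ⊆ Y V) : X.languages ⊆ Y.languages := by
  rintro L ⟨V, ⟨a, ha⟩, K, hK, rfl⟩
  have : Nonempty {a : ℕ // a ∈ V} := ⟨⟨a, ha⟩⟩
  exact ⟨V, ⟨a, ha⟩, K, h _ hK, rfl⟩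

theorem DirectedPath.languages_subset {X Y : Node} (h : DirectedPath X Y) :
    X.family.languages ⊆ Y.family.languages := by
  induction h with
  | refl => exact subset_rfl
  | tail _ h ih => exact ih.trans (Subregular.languages_subset fun V _ _ => h.subset V)

/-- Six steps reach everything reachable, as the longest path in the diagram has length `6`. -/
theorem exists_separation (X Y : Node) : Y ∈ X.reach 6 ∨
    ∃ p ∈ separations, X ∈ p.1.reach 6 ∧ p.2 ∈ Y.reach 6 := by
  cases X <;> cases Y <;> decide

theorem not_subset_of_separation {X Y : Node}
    (h : ∃ p ∈ separations, X ∈ p.1.reach 6 ∧ p.2 ∈ Y.reach 6) :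
    ¬ X.family.languages ⊆ Y.family.languages := by
  obtain ⟨p, hp, hX, hY⟩ := h
  exact fun h => not_subset_of_mem_separations hp
    ((Node.directedPath_of_mem_reach hX).languages_subset.trans
      (h.trans (Node.directedPath_of_mem_reach hY).languages_subset))

theorem not_subset_of_not_directedPath {X Y : Node} (h : ¬ DirectedPath X Y) :
    ¬ X.family.languages ⊆ Y.family.languages :=
  not_subset_of_separation
    ((exists_separation X Y).resolve_left fun h' => h (Node.directedPath_of_mem_reach h'))

theorem Arrow.not_subset {X Y : Node} (h : Arrow X Y) :
    ¬ Y.family.languages ⊆ X.family.languages := by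
  refine not_subset_of_separation ?_
  cases h <;> decide

theorem Arrow.properlyIncluded {X Y : Node} (h : Arrow X Y) :
    ProperlyIncluded X.family Y.family :=
  ⟨fun V _ _ => h.subset V, languages_subset fun V _ _ => h.subset V, h.not_subset⟩

end Diagram

end Subregular

theorem mainTheorem1 :
    (∀ (V : Type) [Finite V] [Nonempty V], Subregular.NC V = Subregular.SF V) ∧
    (∀ X Y : Subregular.Node, Subregular.Arrow X Y →
      Subregular.ProperlyIncluded X.family Y.family) ∧
    (∀ X Y : Subregular.Node, ¬ Subregular.DirectedPath X Y → ¬ Subregular.DirectedPath Y X →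
      Subregular.Incomparable X.family Y.family) :=
  ⟨fun _ _ _ => Subregular.NC_eq_SF, fun _ _ h => h.properlyIncluded, fun _ _ h h' =>
    ⟨Subregular.not_subset_of_not_directedPath h, Subregular.not_subset_of_not_directedPath h'⟩⟩
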